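/- Let $k\ge 0$ be an integer. There is a constant $C_k\in\mathbb{R}$, depending only on $k$, such that the following holds. Let $\mathfrak{H}$ be a separable complex Hilbert space, let $N\ge 1$ be an integer with $N\ge k$, and let $\Psi$ be a normalised fermionic $N$-body state, i.e. a vector $\Psi$ of norm $1$ in the Hilbert space tensor power $\mathfrak{H}^{\otimes N}$ with $U_\sigma\Psi=\operatorname{sgn}(\sigma)\Psi$ for all permutations $\sigma$ of $\{1,\dots,N\}$, where $U_\sigma\,u_1\otimes\dots\otimes u_N=u_{\sigma(1)}\otimes\dots\otimes u_{\sigma(N)}$. Let $$\gamma^{(k)}=\operatorname{Tr}_{k+1\to N}|\Psi\rangle\langle\Psi|$$ be its trace-normalised $k$-particle reduced density matrix, a positive operator of trace $1$ on $\mathfrak{H}^{\otimes k}$. Then the von Neumann entropy $S(\gamma^{(k)})=-\operatorname{Tr}\big(\gamma^{(k)}\log\gamma^{(k)}\big)\in[0,\infty]$ and the $2$-Rényi entropy $S_2(\gamma^{(k)})=-\log\operatorname{Tr}\big[(\gamma^{(k)})^2\big]$ satisfy $$S(\gamma^{(k)})\ \ge\ k\log N-C_k\qquad\text{and}\qquad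 S_2(\gamma^{(k)})\ \ge\ k\log N-C_k .$$ -/

import Mathlib

open scoped InnerProductSpace ENNReal TensorProduct

universe u

noncomputable section

namespace ManyBody

/-! ### The Hilbert space tensor power -/

/-- The algebraic tensor power of `H` with factors indexed by `ι`. It is kept as a type of its own
because Mathlib's `⨂[ℂ] _ : ι, H` already carries a Banach space seminorm, which is not the
Hilbert space one. -/
def AlgTensor (ι : Type*) (H : Type*) [NormedAddCommGroup H] [InnerProductSpace ℂ H] : Type _ :=
  ⨂[ℂ] _ : ι, H

section AlgTensor

variable {ι κ : Type*} {H : Type*} [NormedAddCommGroup H] [InnerProductSpace ℂ H]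

instance : AddCommGroup (AlgTensor ι H) :=
  inferInstanceAs (AddCommGroup (⨂[ℂ] _ : ι, H))

instance : Module ℂ (AlgTensor ι H) :=
  inferInstanceAs (Module ℂ (⨂[ℂ] _ : ι, H))

/-- The elementary tensor `⨂ᵢ v i`. -/
def algTprod : MultilinearMap ℂ (fun _ : ι => H) (AlgTensor ι H) :=
  PiTensorProduct.tprod ℂ

theorem algTensor_induction {p : AlgTensor ι H → Prop}
    (hs : ∀ (c : ℂ) (v : ι → H), p (c • algTprod v))
    (ha : ∀ x y, p x → p y → p (x + y)) (x : AlgTensor ι H) : p x :=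
  PiTensorProduct.induction_on x hs ha

theorem algTensor_hom_ext {f g : AlgTensor ι H →ₗ[ℂ] ℂ}
    (h : ∀ w : ι → H, f (algTprod w) = g (algTprod w)) : f = g := by
  ext x
  induction x using algTensor_induction with
  | hs c v => simp [h]
  | ha x y hx hy => simp [hx, hy]

/-- Relabelling of the tensor factors: `⨂ᵢ v i ↦ ⨂ⱼ v (e⁻¹ j)`. -/
def algReindex (e : ι ≃ κ) : AlgTensor ι H →ₗ[ℂ] AlgTensor κ H :=
  (PiTensorProduct.reindex ℂ (fun _ : ι => H) e).toLinearMap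

@[simp] theorem algReindex_algTprod (e : ι ≃ κ) (v : ι → H) :
    algReindex e (algTprod v) = algTprod fun j => v (e.symm j) :=
  PiTensorProduct.reindex_tprod e v

/-- The bilinear map `(⨂ᵢ v i, ⨂ⱼ w j) ↦ (⨂ᵢ v i) ⊗ (⨂ⱼ w j)`. -/
def algTmul : AlgTensor ι H →ₗ[ℂ] AlgTensor κ H →ₗ[ℂ] AlgTensor (ι ⊕ κ) H :=
  TensorProduct.curry (PiTensorProduct.tmulEquiv (ι := ι) (ι₂ := κ) ℂ H).toLinearMap

@[simp] theorem algTmul_algTprod (v : ι → H) (w : κ → H) :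
    algTmul (algTprod v) (algTprod w) = algTprod (Sum.elim v w) := by
  simp only [algTmul, algTprod]
  exact PiTensorProduct.tmulEquiv_apply (R := ℂ) (M := H) v w

variable [Fintype ι] [Fintype κ]

/-- The linear functional `⨂ᵢ w i ↦ ∏ᵢ ⟪v i, w i⟫`. -/
def pairing (v : ι → H) : AlgTensor ι H →ₗ[ℂ] ℂ :=
  PiTensorProduct.lift
    ((MultilinearMap.mkPiAlgebra ℂ ι ℂ).compLinearMap fun i => innerₛₗ ℂ (v i))

@[simp] theorem pairing_algTprod (v w : ι → H) :
    pairing v (algTprod w) = ∏ i, ⟪v i, w i⟫_ℂ := by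
  simp only [pairing, algTprod]
  erw [PiTensorProduct.lift.tprod]
  simp

/-- The sesquilinear form with `(⨂ᵢ v i, ⨂ᵢ u i) ↦ ∏ᵢ ⟪u i, v i⟫`, linear in the first and
conjugate-linear in the second argument. -/
def innerForm : AlgTensor ι H →ₗ[ℂ] (AlgTensor ι H →ₗ⋆[ℂ] ℂ) :=
  PiTensorProduct.lift
    { toFun := fun v => (starLinearEquiv ℂ : ℂ ≃ₗ⋆[ℂ] ℂ).toLinearMap.comp (pairing v)
      map_update_add' := by
        intro _ v i x y
        have : pairing (Function.update v i (x + y)) =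
            pairing (Function.update v i x) + pairing (Function.update v i y) := by
          apply algTensor_hom_ext
          intro w
          simp only [LinearMap.add_apply, pairing_algTprod]
          simp only [← Finset.mul_prod_erase Finset.univ _ (Finset.mem_univ i),
            Function.update_self, inner_add_left, add_mul]
          congr 1 <;> congr 1 <;> refine Finset.prod_congr rfl fun j hj => ?_ <;>
            simp [Function.update_of_ne (Finset.ne_of_mem_erase hj)]
        rw [this]
        ext z
        simp
      map_update_smul' := by
        intro _ v i c x
        have : pairing (Function.update v i (c • x)) =
            (starRingEnd ℂ c) • pairing (Function.update v i x) := by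
          apply algTensor_hom_ext
          intro w
          simp only [LinearMap.smul_apply, pairing_algTprod]
          simp only [← Finset.mul_prod_erase Finset.univ _ (Finset.mem_univ i),
            Function.update_self, inner_smul_left, smul_eq_mul, mul_assoc]
          congr 2
          refine Finset.prod_congr rfl fun j hj => ?_
          simp [Function.update_of_ne (Finset.ne_of_mem_erase hj)]
        rw [this]
        ext z
        simp }

@[simp] theorem innerForm_algTprod (v u : ι → H) :
    innerForm (algTprod v) (algTprod u) = ∏ i, ⟪u i, v i⟫_ℂ := by
  have : innerForm (algTprod v) =
      (starLinearEquiv ℂ : ℂ ≃ₗ⋆[ℂ] ℂ).toLinearMap.comp (pairing v) := by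
    simp only [innerForm, algTprod]
    erw [PiTensorProduct.lift.tprod]
    rfl
  rw [this]
  simp

theorem innerForm_conj (x y : AlgTensor ι H) :
    starRingEnd ℂ (innerForm x y) = innerForm y x := by
  induction x using algTensor_induction with
  | ha x x' hx hx' => simp [hx, hx']
  | hs c v =>
    induction y using algTensor_induction with
    | ha y y' hy hy' => simp only [map_add, hy, hy', LinearMap.add_apply]
    | hs d w =>
      simp only [map_smul, LinearMap.smul_apply, LinearMap.map_smulₛₗ, innerForm_algTprod,
        smul_eq_mul, map_mul, map_prod, inner_conj_symm, RingHomCompTriple.comp_apply,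
        RingHom.id_apply]
      ring

open scoped ComplexOrder in
theorem innerForm_self_nonneg (x : AlgTensor ι H) : 0 ≤ (innerForm x x).re := by
  classical
  obtain ⟨n, c, v, rfl⟩ : ∃ (n : ℕ) (c : Fin n → ℂ) (v : Fin n → ι → H),
      x = ∑ a, c a • algTprod (v a) := by
    induction x using algTensor_induction with
    | hs c v => exact ⟨1, fun _ => c, fun _ => v, by simp⟩
    | ha x y hx hy =>
      obtain ⟨n, c, v, rfl⟩ := hx
      obtain ⟨m, d, w, rfl⟩ := hy
      exact ⟨n + m, Fin.append c d, Fin.append v w, by simp [Fin.sum_univ_add]⟩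
  have key : ∀ s : Finset ι,
      (Matrix.of fun a b : Fin n => ∏ i ∈ s, ⟪v a i, v b i⟫_ℂ).PosSemidef := by
    intro s
    induction s using Finset.induction_on with
    | empty =>
      have := Matrix.posSemidef_vecMulVec_self_star (fun _ : Fin n => (1 : ℂ))
      convert this using 1
      ext a b
      simp [Matrix.vecMulVec]
    | insert i s hi ih =>
      have h1 : (Matrix.gram ℂ fun a : Fin n => v a i).PosSemidef := Matrix.posSemidef_gram ..
      have h2 : (Matrix.of fun a b : Fin n => ∏ i ∈ insert i s, ⟪v a i, v b i⟫_ℂ) =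
          (Matrix.gram ℂ fun a : Fin n => v a i).hadamard
            (Matrix.of fun a b : Fin n => ∏ i ∈ s, ⟪v a i, v b i⟫_ℂ) := by
        ext a b
        simp [Finset.prod_insert hi, Matrix.gram, Matrix.hadamard]
      rw [h2]
      exact h1.hadamard ih
  have h := (Matrix.posSemidef_iff_dotProduct_mulVec.1 (key Finset.univ)).2 c
  have h2 : innerForm (∑ a, c a • algTprod (v a)) (∑ a, c a • algTprod (v a)) =
      star c ⬝ᵥ (Matrix.of fun a b : Fin n => ∏ i, ⟪v a i, v b i⟫_ℂ).mulVec c := by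
    simp only [map_sum, LinearMap.sum_apply, map_smul, LinearMap.smul_apply, LinearMap.map_smulₛₗ,
      innerForm_algTprod, dotProduct, Matrix.mulVec, Finset.mul_sum, Matrix.of_apply,
      Pi.star_apply, smul_eq_mul, RCLike.star_def]
    refine Finset.sum_congr rfl fun a _ => Finset.sum_congr rfl fun b _ => ?_
    ring
  rw [h2]
  exact (Complex.nonneg_iff.1 h).1

instance : PreInnerProductSpace.Core ℂ (AlgTensor ι H) where
  inner x y := innerForm y x
  conj_inner_symm x y := innerForm_conj x y
  re_inner_nonneg x := innerForm_self_nonneg x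
  add_left x y z := by simp
  smul_left x y c := by simp

instance : SeminormedAddCommGroup (AlgTensor ι H) :=
  InnerProductSpace.Core.toSeminormedAddCommGroup (𝕜 := ℂ)

instance : InnerProductSpace ℂ (AlgTensor ι H) := InnerProductSpace.ofCore _

@[simp] theorem inner_algTprod (u v : ι → H) :
    ⟪algTprod u, algTprod v⟫_ℂ = ∏ i, ⟪u i, v i⟫_ℂ :=
  innerForm_algTprod v u

theorem inner_algTmul (x x' : AlgTensor ι H) (y y' : AlgTensor κ H) :
    ⟪algTmul x y, algTmul x' y'⟫_ℂ = ⟪x, x'⟫_ℂ * ⟪y, y'⟫_ℂ := by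
  induction x using algTensor_induction with
  | ha x₁ x₂ h₁ h₂ => simp only [map_add, LinearMap.add_apply, inner_add_left, h₁, h₂, add_mul]
  | hs a u =>
  induction y using algTensor_induction with
  | ha x₁ x₂ h₁ h₂ => simp only [map_add, inner_add_left, h₁, h₂, mul_add]
  | hs b v =>
  induction x' using algTensor_induction with
  | ha x₁ x₂ h₁ h₂ => simp only [map_add, LinearMap.add_apply, inner_add_right, h₁, h₂, add_mul]
  | hs c w =>
  induction y' using algTensor_induction with
  | ha x₁ x₂ h₁ h₂ => simp only [map_add, inner_add_right, h₁, h₂, mul_add]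
  | hs d z =>
  simp only [map_smul, LinearMap.smul_apply, inner_smul_left, inner_smul_right, algTmul_algTprod,
    inner_algTprod, Fintype.prod_sum_type, Sum.elim_inl, Sum.elim_inr]
  ring

theorem norm_algTmul (x : AlgTensor ι H) (y : AlgTensor κ H) :
    ‖algTmul x y‖ = ‖x‖ * ‖y‖ := by
  have h : ‖algTmul x y‖ ^ 2 = (‖x‖ * ‖y‖) ^ 2 := by
    have := inner_algTmul x x y y
    simp only [inner_self_eq_norm_sq_to_K] at this
    rw [mul_pow]
    exact_mod_cast this
  exact (sq_eq_sq₀ (norm_nonneg _) (by positivity)).1 h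

theorem inner_algReindex (e : ι ≃ κ) (x y : AlgTensor ι H) :
    ⟪algReindex e x, algReindex e y⟫_ℂ = ⟪x, y⟫_ℂ := by
  induction x using algTensor_induction with
  | ha x₁ x₂ h₁ h₂ => simp only [map_add, inner_add_left, h₁, h₂]
  | hs a u =>
  induction y using algTensor_induction with
  | ha x₁ x₂ h₁ h₂ => simp only [map_add, inner_add_right, h₁, h₂]
  | hs b v =>
  simp only [map_smul, inner_smul_left, inner_smul_right, algReindex_algTprod, inner_algTprod]
  rw [Equiv.prod_comp e.symm fun i => ⟪u i, v i⟫_ℂ]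

end AlgTensor

/-- The Hilbert space tensor power `H^{⊗ι}`: the completion of the algebraic tensor power with
respect to the inner product `⟪⨂ᵢ u i, ⨂ᵢ v i⟫ = ∏ᵢ ⟪u i, v i⟫`. -/
abbrev TensorPow (ι : Type*) [Fintype ι] (H : Type*) [NormedAddCommGroup H]
    [InnerProductSpace ℂ H] : Type _ :=
  UniformSpace.Completion (AlgTensor ι H)

section TensorPow

variable {ι κ : Type*} [Fintype ι] [Fintype κ]
variable {H : Type*} [NormedAddCommGroup H] [InnerProductSpace ℂ H]

/-- The canonical map from the algebraic tensor power to its completion. -/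
def toTensorPow : AlgTensor ι H →L[ℂ] TensorPow ι H := UniformSpace.Completion.toComplL

theorem denseRange_toTensorPow : DenseRange (toTensorPow : AlgTensor ι H → TensorPow ι H) :=
  UniformSpace.Completion.denseRange_coe

theorem isUniformInducing_toTensorPow :
    IsUniformInducing (toTensorPow : AlgTensor ι H → TensorPow ι H) :=
  UniformSpace.Completion.isUniformInducing_coe _

/-- The elementary tensor `⨂ᵢ v i` in the Hilbert space tensor power. -/
def tprod (v : ι → H) : TensorPow ι H := toTensorPow (algTprod v)

theorem inner_tprod (u v : ι → H) : ⟪tprod u, tprod v⟫_ℂ = ∏ i, ⟪u i, v i⟫_ℂ :=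
  (UniformSpace.Completion.inner_coe _ _).trans (inner_algTprod u v)

/-- The tensor product on algebraic tensors, with values in the completion. -/
def tmulAux : AlgTensor ι H →L[ℂ] AlgTensor κ H →L[ℂ] TensorPow (ι ⊕ κ) H :=
  LinearMap.mkContinuous₂ ((algTmul (H := H)).compr₂ toTensorPow.toLinearMap) 1 fun x y => by
    have : ‖toTensorPow (algTmul x y)‖ = ‖algTmul x y‖ := UniformSpace.Completion.norm_coe _
    simp [this, norm_algTmul]

/-- The tensor product `(φ, χ) ↦ φ ⊗ χ` as a bounded bilinear map
`H^{⊗ι} × H^{⊗κ} → H^{⊗(ι ⊕ κ)}`. -/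
def tmul : TensorPow ι H →L[ℂ] TensorPow κ H →L[ℂ] TensorPow (ι ⊕ κ) H :=
  ((tmulAux.extend toTensorPow).flip.extend toTensorPow).flip

theorem tmul_toTensorPow (x : AlgTensor ι H) (y : AlgTensor κ H) :
    tmul (toTensorPow x) (toTensorPow y) = toTensorPow (algTmul x y) := by
  simp only [tmul, ContinuousLinearMap.flip_apply]
  rw [ContinuousLinearMap.extend_eq _ denseRange_toTensorPow isUniformInducing_toTensorPow,
    ContinuousLinearMap.flip_apply,
    ContinuousLinearMap.extend_eq _ denseRange_toTensorPow isUniformInducing_toTensorPow]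
  rfl

theorem tmul_tprod (v : ι → H) (w : κ → H) :
    tmul (tprod v) (tprod w) = tprod (Sum.elim v w) := by
  simp [tprod, tmul_toTensorPow]

theorem inner_tmul (x x' : TensorPow ι H) (y y' : TensorPow κ H) :
    ⟪tmul x y, tmul x' y'⟫_ℂ = ⟪x, x'⟫_ℂ * ⟪y, y'⟫_ℂ := by
  induction x, x' using UniformSpace.Completion.induction_on₂ with
  | hp => exact isClosed_eq (by fun_prop) (by fun_prop)
  | ih x x' =>
  induction y, y' using UniformSpace.Completion.induction_on₂ with
  | hp => exact isClosed_eq (by fun_prop) (by fun_prop)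
  | ih y y' =>
  have h : ∀ (x : AlgTensor ι H) (y : AlgTensor κ H), tmul (x : TensorPow ι H) (y : TensorPow κ H) =
      ((algTmul x y : AlgTensor (ι ⊕ κ) H) : TensorPow (ι ⊕ κ) H) := tmul_toTensorPow
  simp only [h, UniformSpace.Completion.inner_coe, inner_algTmul]

/-- Relabelling of the tensor factors, `⨂ᵢ v i ↦ ⨂ⱼ v (e⁻¹ j)`, on the completion. -/
def reindex (e : ι ≃ κ) : TensorPow ι H →L[ℂ] TensorPow κ H :=
  (toTensorPow.comp
    ((algReindex (H := H) e).isometryOfInner (inner_algReindex e)).toContinuousLinearMap).extend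
      toTensorPow

theorem reindex_tprod (e : ι ≃ κ) (v : ι → H) :
    reindex e (tprod v) = tprod fun j => v (e.symm j) := by
  simp only [reindex, tprod]
  rw [ContinuousLinearMap.extend_eq _ denseRange_toTensorPow isUniformInducing_toTensorPow]
  simp

end TensorPow

/-! ### Fermionic states -/

section Fermions

variable {H : Type*} [NormedAddCommGroup H] [InnerProductSpace ℂ H]

/-- The permutation operator `U_σ (u₁ ⊗ ⋯ ⊗ u_N) = u_{σ(1)} ⊗ ⋯ ⊗ u_{σ(N)}`. -/
def permOp {N : ℕ} (σ : Equiv.Perm (Fin N)) : TensorPow (Fin N) H →L[ℂ] TensorPow (Fin N) H :=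
  reindex σ.symm

theorem permOp_tprod {N : ℕ} (σ : Equiv.Perm (Fin N)) (u : Fin N → H) :
    permOp σ (tprod u) = tprod fun i => u (σ i) := by
  simp [permOp, reindex_tprod]

/-- The fermionic `N`-body space `H^{∧N}`: the vectors `Ψ` with `U_σ Ψ = sgn(σ) Ψ` for all `σ`. -/
def fermionic (N : ℕ) (H : Type*) [NormedAddCommGroup H] [InnerProductSpace ℂ H] :
    Submodule ℂ (TensorPow (Fin N) H) where
  carrier := {Ψ | ∀ σ : Equiv.Perm (Fin N), permOp σ Ψ = ((Equiv.Perm.sign σ : ℤ) : ℂ) • Ψ}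
  add_mem' := by
    intro a b ha hb σ
    rw [map_add, ha σ, hb σ, smul_add]
  zero_mem' := by
    intro σ
    simp
  smul_mem' := by
    intro c x hx σ
    rw [map_smul, hx σ, smul_comm]

end Fermions

/-! ### Traces, partial traces and reduced density matrices -/

section Trace

theorem tsum_enorm_inner_sq {ι E : Type*} [NormedAddCommGroup E] [InnerProductSpace ℂ E]
    (b : HilbertBasis ι ℂ E) (x : E) :
    ∑' i, ENNReal.ofReal (‖⟪b i, x⟫_ℂ‖ ^ 2) = ENNReal.ofReal (‖x‖ ^ 2) := by
  have h := (b.hasSum_inner_mul_inner x x).mapL (Complex.reCLM)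
  have h' : HasSum (fun i => ‖⟪b i, x⟫_ℂ‖ ^ 2) (‖x‖ ^ 2) := by
    convert h using 1
    · ext i
      rw [← inner_conj_symm x (b i), ← Complex.normSq_eq_conj_mul_self]
      rw [Complex.normSq_eq_norm_sq]
      exact (Complex.ofReal_re _).symm
    · rw [inner_self_eq_norm_sq_to_K]
      norm_cast
  rw [← h'.tsum_eq, ENNReal.ofReal_tsum_of_nonneg (fun _ => by positivity) h'.summable]

variable {E : Type*} [NormedAddCommGroup E] [InnerProductSpace ℂ E] [CompleteSpace E]

variable (E) in
/-- The index set of some Hilbert basis (complete orthonormal system) of `E`. -/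
def stdIndex : Set E := (exists_hilbertBasis ℂ E).choose

variable (E) in
/-- Some Hilbert basis (complete orthonormal system) of `E`. -/
def stdBasis : HilbertBasis (stdIndex E) ℂ E := (exists_hilbertBasis ℂ E).choose_spec.choose

/-- The trace `∑ᵢ ⟪eᵢ, A eᵢ⟫ ∈ [0, ∞]` of a positive operator `A`. It does not depend on the
Hilbert basis, see `posTrace_eq`. -/
def posTrace (A : E →L[ℂ] E) : ℝ≥0∞ :=
  ∑' i, ENNReal.ofReal (⟪stdBasis E i, A (stdBasis E i)⟫_ℂ).re

theorem posTrace_eq {ι : Type*} (b : HilbertBasis ι ℂ E) {A : E →L[ℂ] E} (hA : 0 ≤ A) :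
    posTrace A = ∑' i, ENNReal.ofReal (⟪b i, A (b i)⟫_ℂ).re := by
  obtain ⟨B, hB, rfl⟩ : ∃ B : E →L[ℂ] E, IsSelfAdjoint B ∧ B * B = A :=
    ⟨CFC.sqrt A, (CFC.sqrt_nonneg A).isSelfAdjoint, CFC.sqrt_mul_sqrt_self A hA⟩
  have hs : ∀ x y, ⟪B x, y⟫_ℂ = ⟪x, B y⟫_ℂ := fun x y => hB.isSymmetric x y
  have h : ∀ x : E, (⟪x, (B * B) x⟫_ℂ).re = ‖B x‖ ^ 2 := by
    intro x
    have : ⟪x, (B * B) x⟫_ℂ = ⟪B x, B x⟫_ℂ := (hs x (B x)).symm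
    rw [this, inner_self_eq_norm_sq_to_K]
    norm_cast
  simp only [posTrace, h]
  simp only [← tsum_enorm_inner_sq (stdBasis E) (B (b _))]
  rw [ENNReal.tsum_comm]
  refine tsum_congr fun i => ?_
  rw [← tsum_enorm_inner_sq b]
  refine tsum_congr fun j => ?_
  rw [← hs, norm_inner_symm]

end Trace

section PartialTrace

variable {ι κ : Type*} [Fintype ι] [Fintype κ]
variable {H : Type*} [NormedAddCommGroup H] [InnerProductSpace ℂ H]

/-- The operator `φ ↦ φ ⊗ χ` from `H^{⊗ι}` to `H^{⊗(ι ⊕ κ)}`. -/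
def tensorRight (χ : TensorPow κ H) : TensorPow ι H →L[ℂ] TensorPow (ι ⊕ κ) H :=
  tmul.flip χ

/-- The partial trace over the factors indexed by `κ` of an operator `T` on
`H^{⊗ι} ⊗ H^{⊗κ} = H^{⊗(ι ⊕ κ)}`: the operator on `H^{⊗ι}` with
`⟪φ, (Tr_κ T) φ'⟫ = ∑ⱼ ⟪φ ⊗ eⱼ, T (φ' ⊗ eⱼ)⟫`, where `(eⱼ)` is a Hilbert basis of `H^{⊗κ}`.
The series converges in operator norm if `T` is of trace class, see `hasSum_partialTrace` for the
operators used here. -/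
def partialTrace (T : TensorPow (ι ⊕ κ) H →L[ℂ] TensorPow (ι ⊕ κ) H) :
    TensorPow ι H →L[ℂ] TensorPow ι H :=
  ∑' j, (tensorRight (stdBasis (TensorPow κ H) j)).adjoint ∘L T ∘L
    tensorRight (stdBasis (TensorPow κ H) j)

theorem summable_norm_adjoint_tensorRight {α : Type*} (b : HilbertBasis α ℂ (TensorPow κ H))
    (Ψ : TensorPow (ι ⊕ κ) H) :
    Summable fun j => ‖(tensorRight (ι := ι) (b j)).adjoint Ψ‖ ^ 2 := by
  classical
  have ho : Orthonormal ℂ fun p : α × stdIndex (TensorPow ι H) =>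
      tmul (stdBasis (TensorPow ι H) p.2) (b p.1) := by
    rw [orthonormal_iff_ite]
    rintro ⟨i, j⟩ ⟨i', j'⟩
    rw [inner_tmul, orthonormal_iff_ite.1 (stdBasis (TensorPow ι H)).orthonormal,
      orthonormal_iff_ite.1 b.orthonormal]
    by_cases h₁ : i = i' <;> by_cases h₂ : j = j' <;> simp [h₁, h₂]
  have hs := (ho.inner_products_summable (x := Ψ)).prod
  refine hs.congr fun j => ?_
  have h := tsum_enorm_inner_sq (stdBasis (TensorPow ι H)) ((tensorRight (b j)).adjoint Ψ)
  have h₁ : ∀ i, ⟪stdBasis (TensorPow ι H) i, (tensorRight (b j)).adjoint Ψ⟫_ℂ =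
      ⟪tmul (stdBasis (TensorPow ι H) i) (b j), Ψ⟫_ℂ := fun i =>
    ContinuousLinearMap.adjoint_inner_right _ _ _
  simp only [h₁] at h
  rw [← ENNReal.ofReal_tsum_of_nonneg (fun _ => by positivity)
    ((ho.inner_products_summable (x := Ψ)).prod_factor j)] at h
  exact ((ENNReal.ofReal_eq_ofReal_iff (tsum_nonneg fun _ => by positivity)
    (by positivity)).1 h)

theorem hasSum_partialTrace (Ψ : TensorPow (ι ⊕ κ) H) :
    HasSum (fun j => (tensorRight (ι := ι) (stdBasis (TensorPow κ H) j)).adjoint ∘L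
        InnerProductSpace.rankOne ℂ Ψ Ψ ∘L tensorRight (stdBasis (TensorPow κ H) j))
      (partialTrace (InnerProductSpace.rankOne ℂ Ψ Ψ)) := by
  refine Summable.hasSum (Summable.of_norm ?_)
  refine (summable_norm_adjoint_tensorRight (ι := ι) (stdBasis (TensorPow κ H)) Ψ).congr fun j => ?_
  rw [InnerProductSpace.rankOne_comp, InnerProductSpace.comp_rankOne,
    InnerProductSpace.norm_rankOne, sq]

end PartialTrace

section DensityMatrix

variable {H : Type*} [NormedAddCommGroup H] [InnerProductSpace ℂ H]

/-- The splitting of `N` particles into the first `k` and the remaining `N - k` ones. -/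
def splitEquiv {k N : ℕ} (hk : k ≤ N) : Fin N ≃ Fin k ⊕ Fin (N - k) :=
  ((finCongr (Nat.add_sub_of_le hk).symm).trans finSumFinEquiv.symm)

/-- The trace normalised `k`-particle reduced density matrix
`γ^{(k)} = Tr_{k+1 → N} |Ψ⟩⟨Ψ|` of `Ψ ∈ H^{⊗N}`, an operator on `H^{⊗k}`. -/
def reducedDensity {k N : ℕ} (hk : k ≤ N) (Ψ : TensorPow (Fin N) H) :
    TensorPow (Fin k) H →L[ℂ] TensorPow (Fin k) H :=
  partialTrace (InnerProductSpace.rankOne ℂ (reindex (splitEquiv hk) Ψ)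
    (reindex (splitEquiv hk) Ψ))

end DensityMatrix

/-! ### Entropies -/

section Entropy

variable {E : Type*} [NormedAddCommGroup E] [InnerProductSpace ℂ E] [CompleteSpace E]

/-- The von Neumann entropy `S(γ) = -Tr(γ log γ) ∈ [0, ∞]` of a density matrix `γ`. The operator
`-γ log γ` is defined by the continuous functional calculus with `x ↦ -x log x` (and `0 ↦ 0`); it
is positive because the spectrum of `γ` lies in `[0, 1]`. -/
def vonNeumannEntropy (γ : E →L[ℂ] E) : EReal :=
  (posTrace (cfc Real.negMulLog γ) : EReal)

/-- The 2-Rényi entropy `S₂(γ) = -log Tr(γ²)` of a density matrix `γ`. -/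
def renyiTwoEntropy (γ : E →L[ℂ] E) : EReal :=
  -ENNReal.log (posTrace (γ ^ 2))

end Entropy

end ManyBody

end

/-! Both entropies are controlled by the purity `p_k = Tr (γ^(k))²`, so the point is `p_k ≤ D / N^k`
(`exists_posTrace_reducedDensity_sq_le`). The Rényi bound is then immediate, and the von Neumann
bound follows from `-x log x ≥ (1 - log s) x - x² / s` with `s = D / N^k` (`vonNeumannEntropy_ge`).

The purity `p_k` is the expectation in `X = Ψ ⊗ Ψ` of the exchange of the first `k` particles
between the two copies. Let `S_2N` act on the two copies with an additional sign, `W π = sgn π ·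
U_π`. Antisymmetry makes `X` invariant under `S_N × S_N`, so `⟪X, W π X⟫` depends only on the double
coset of `π`, that is, on the number `k` of points of the first copy sent to the second; its real
part is `(-1)^k p_k`.

Let `a = 1 + T / N`, where `T` is the sum of the `W`-images of all transpositions between the
copies. Counting how a transposition changes the crossing number gives a three-term recursion, hence
`N^k ⟪Y, W π X⟫ = ⟪Y, P_k(a) X⟫` with a polynomial `P_k` of degree `k` (`card_pow_mul_inner_eq`). On
bi-invariant vectors `a ≥ 0`, since `N + T` is a sum of positive multiples of projections
(`crossOp_nonneg`).

The sign now decides. As `p_{2k+1} ≥ 0`, the odd coefficient satisfies `⟪X, P_{2k+1}(a) X⟫ =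
-N^{2k+1} p_{2k+1} ≤ 0`. Since `P_{2k+1}` has higher degree than `P_k` and a leading coefficient at
least `1`, `|P_k| ≤ D + P_{2k+1}` on `[0, ∞)` with `D` independent of `N`
(`exists_abs_crossPoly_le`). Taking expectations gives `N^k p_k ≤ D` for `N ≥ 2(2k+1)`; smaller `N`
are covered by `p_k ≤ 1`. -/

noncomputable section

namespace ManyBody

/-! ### Double cosets of `S_n × S_n` in `S_2n` and their crossing numbers. -/

section CrossingNumber

variable {n : Type*} [Fintype n]

/-- The number of elements of the left summand which `π` maps to the right summand. -/
def crossing (π : Equiv.Perm (n ⊕ n)) : ℕ :=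
  Fintype.card {i : n // (π (Sum.inl i)).isRight = true}

theorem exists_perm_iff_of_card_eq {p q : n → Prop} [DecidablePred p] [DecidablePred q]
    (h : Fintype.card {x // p x} = Fintype.card {x // q x}) :
    ∃ σ : Equiv.Perm n, ∀ x, p x ↔ q (σ x) := by
  obtain e := Fintype.equivOfCardEq h
  refine ⟨e.extendSubtype, fun x => ⟨fun hx => e.extendSubtype_mem x hx, fun hx => ?_⟩⟩
  by_contra hp
  exact e.extendSubtype_not_mem x hp hx

theorem crossing_eq_sum (π : Equiv.Perm (n ⊕ n)) :
    (crossing π : ℤ) = ∑ l, if (π (Sum.inl l)).isRight = true then 1 else 0 := by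
  simp [crossing, Fintype.card_subtype]

/-- Exactly `card n` points land in the left summand, so as many points enter it as leave it. -/
theorem card_inr_isLeft (π : Equiv.Perm (n ⊕ n)) :
    Fintype.card {i : n // (π (Sum.inr i)).isLeft = true} = crossing π := by
  have h1 : ∑ x : n ⊕ n, (if (π x).isLeft = true then 1 else 0 : ℤ) = Fintype.card n := by
    rw [Equiv.sum_comp π fun x => (if x.isLeft = true then 1 else 0 : ℤ),
      Fintype.sum_sum_type]
    simp
  have h2 := crossing_eq_sum π
  rw [Fintype.sum_sum_type] at h1
  have h3 : ∑ l : n, ((if (π (Sum.inl l)).isRight = true then 1 else 0 : ℤ) +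
      if (π (Sum.inl l)).isLeft = true then 1 else 0) = Fintype.card n := by
    rw [Finset.sum_congr rfl (g := fun _ => 1)]
    · simp
    · intro l _
      cases π (Sum.inl l) <;> simp
  rw [Finset.sum_add_distrib] at h3
  have h4 : (Fintype.card {i : n // (π (Sum.inr i)).isLeft = true} : ℤ) =
      ∑ l, if (π (Sum.inr l)).isLeft = true then 1 else 0 := by
    simp [Fintype.card_subtype]
  omega

-- The crossing number is a complete invariant of the double coset. A block permutation `t` can
-- match the crossing points of `π'` with those of `π`; then `π' * t⁻¹ * π⁻¹` preserves the left
-- summand and is itself a block permutation.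
open scoped Classical in
theorem exists_eq_mul_mul_of_crossing_eq {π π' : Equiv.Perm (n ⊕ n)}
    (h : crossing π = crossing π') :
    ∃ s ∈ (Equiv.Perm.sumCongrHom n n).range, ∃ t ∈ (Equiv.Perm.sumCongrHom n n).range,
      π' = s * π * t := by
  obtain ⟨σ, hσ⟩ := exists_perm_iff_of_card_eq (p := fun i => (π' (Sum.inl i)).isRight = true)
    (q := fun i => (π (Sum.inl i)).isRight = true) h.symm
  obtain ⟨τ, hτ⟩ := exists_perm_iff_of_card_eq (p := fun i => (π' (Sum.inr i)).isLeft = true)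
    (q := fun i => (π (Sum.inr i)).isLeft = true)
    ((card_inr_isLeft π').trans (h.symm.trans (card_inr_isLeft π).symm))
  set t := Equiv.Perm.sumCongrHom n n (σ, τ) with ht
  have key : ∀ x, (π' x).isLeft = (π (t x)).isLeft := by
    rintro (i | i)
    · have := hσ i
      simp only [ht, Equiv.Perm.sumCongrHom_apply, Equiv.Perm.sumCongr_apply, Sum.map_inl]
      revert this
      cases π' (Sum.inl i) <;> cases π (Sum.inl (σ i)) <;> simp
    · have := hτ i
      simp only [ht, Equiv.Perm.sumCongrHom_apply, Equiv.Perm.sumCongr_apply, Sum.map_inr]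
      revert this
      cases π' (Sum.inr i) <;> cases π (Sum.inr (τ i)) <;> simp
  refine ⟨π' * t⁻¹ * π⁻¹, ?_, t, ⟨_, rfl⟩, by group⟩
  apply Equiv.Perm.mem_sumCongrHom_range_of_perm_mapsTo_inl
  rintro _ ⟨i, rfl⟩
  have := key ((t⁻¹ * π⁻¹) (Sum.inl i))
  rw [← Equiv.Perm.mul_apply, ← Equiv.Perm.mul_apply, ← Equiv.Perm.mul_apply] at this
  have h2 : π * t * (t⁻¹ * π⁻¹) = 1 := by group
  rw [h2] at this
  simp only [Equiv.Perm.one_apply, Sum.isLeft_inl] at this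
  obtain ⟨y, hy⟩ := Sum.isLeft_iff.1 this
  exact ⟨y, by rw [mul_assoc]; exact hy.symm⟩

open scoped Classical in
theorem exists_crossing_eq {k : ℕ} (hk : k ≤ Fintype.card n) :
    ∃ π : Equiv.Perm (n ⊕ n), crossing π = k := by
  obtain ⟨s, -, hs⟩ := Finset.exists_subset_card_eq (s := (Finset.univ : Finset n)) hk
  have hinv : Function.Involutive fun x : n ⊕ n =>
      Sum.elim (fun i => if i ∈ s then Sum.inr i else Sum.inl i)
        (fun i => if i ∈ s then Sum.inl i else Sum.inr i) x := by
    rintro (i | i) <;> by_cases hi : i ∈ s <;> simp [hi]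
  refine ⟨hinv.toPerm, ?_⟩
  rw [crossing, Fintype.card_subtype, ← hs]
  congr 1
  ext i
  rw [Finset.mem_filter]
  by_cases hi : i ∈ s <;> simp [hi]

variable [DecidableEq n]

/-- Each of the two sums is `0` or `1`: it records whether the preimage of `i`, respectively `j`,
lies in the left summand. -/
theorem crossing_swap_mul (π : Equiv.Perm (n ⊕ n)) (i j : n) :
    (crossing (Equiv.swap (Sum.inl i) (Sum.inr j) * π) : ℤ) = crossing π +
      (∑ l, if π (Sum.inl l) = Sum.inl i then 1 else 0) -
      ∑ l, if π (Sum.inl l) = Sum.inr j then 1 else 0 := by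
  rw [crossing_eq_sum, crossing_eq_sum, ← Finset.sum_add_distrib, ← Finset.sum_sub_distrib]
  refine Finset.sum_congr rfl fun l _ => ?_
  rw [Equiv.Perm.mul_apply]
  generalize π (Sum.inl l) = x
  rw [Equiv.swap_apply_def]
  rcases x with x | x
  · by_cases h : x = i <;> simp [h]
  · by_cases h : x = j <;> simp [h]

theorem sum_ite_apply_inl_eq (π : Equiv.Perm (n ⊕ n)) (y : n ⊕ n) :
    (∑ l, if π (Sum.inl l) = y then 1 else 0 : ℤ) =
      if (π.symm y).isLeft = true then 1 else 0 := by
  rcases hx : π.symm y with x | x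
  · have : ∀ l, π (Sum.inl l) = y ↔ l = x := fun l => by
      rw [← Equiv.eq_symm_apply, hx, Sum.inl.injEq]
    simp [this]
  · have : ∀ l, ¬ π (Sum.inl l) = y := fun l => by
      rw [← Equiv.eq_symm_apply, hx]
      simp
    simp [this]

/-- With `c = crossing π`, there are `card n - c` indices `i` and `c` indices `j` with preimage in
the left summand. The first kind of index raises the crossing number by one, the second lowers it by
one, independently of each other. -/
theorem sum_crossing_swap_mul (π : Equiv.Perm (n ⊕ n)) (f : ℕ → ℂ) :
    ∑ i, ∑ j, f (crossing (Equiv.swap (Sum.inl i) (Sum.inr j) * π)) =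
      ((Fintype.card n : ℂ) - crossing π) ^ 2 * f (crossing π + 1) +
      2 * crossing π * ((Fintype.card n : ℂ) - crossing π) * f (crossing π) +
      (crossing π : ℂ) ^ 2 * f (crossing π - 1) := by
  set x : n → ℂ := fun i => if (π.symm (Sum.inl i)).isLeft = true then 1 else 0 with hx
  set y : n → ℂ := fun j => if (π.symm (Sum.inr j)).isLeft = true then 1 else 0 with hy
  have hys : ∑ j, y j = crossing π := by
    have : ∑ j, (∑ l, if π (Sum.inl l) = Sum.inr j then 1 else 0 : ℤ) = crossing π := by
      rw [Finset.sum_comm, crossing_eq_sum]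
      refine Finset.sum_congr rfl fun l _ => ?_
      cases π (Sum.inl l) <;> simp
    simp only [sum_ite_apply_inl_eq] at this
    have h2 := congrArg (Int.cast : ℤ → ℂ) this
    push_cast at h2
    exact h2
  have hxs : ∑ i, x i = Fintype.card n - crossing π := by
    have : ∑ i, (∑ l, if π (Sum.inl l) = Sum.inl i then 1 else 0 : ℤ) =
        Fintype.card n - crossing π := by
      rw [Finset.sum_comm, crossing_eq_sum, eq_sub_iff_add_eq, ← Finset.sum_add_distrib,
        Finset.sum_congr rfl (g := fun _ => 1)]
      · simp
      · intro l _
        cases π (Sum.inl l) <;> simp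
    simp only [sum_ite_apply_inl_eq] at this
    have h2 := congrArg (Int.cast : ℤ → ℂ) this
    push_cast at h2
    exact h2
  have h : ∀ i j, f (crossing (Equiv.swap (Sum.inl i) (Sum.inr j) * π)) =
      x i * f (crossing π + 1) - x i * y j * f (crossing π + 1) +
      (2 * (x i * y j) + 1 - x i - y j) * f (crossing π) +
      (y j * f (crossing π - 1) - x i * y j * f (crossing π - 1)) := by
    intro i j
    have h1 := crossing_swap_mul π i j
    rw [sum_ite_apply_inl_eq, sum_ite_apply_inl_eq] at h1
    simp only [hx, hy]
    split_ifs at h1 ⊢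
    · rw [show crossing (Equiv.swap (Sum.inl i) (Sum.inr j) * π) = crossing π by omega]
      ring
    · rw [show crossing (Equiv.swap (Sum.inl i) (Sum.inr j) * π) = crossing π + 1 by omega]
      ring
    · rw [show crossing (Equiv.swap (Sum.inl i) (Sum.inr j) * π) = crossing π - 1 by omega]
      ring
    · rw [show crossing (Equiv.swap (Sum.inl i) (Sum.inr j) * π) = crossing π by omega]
      ring
  simp only [h, Finset.sum_add_distrib, Finset.sum_sub_distrib, ← Finset.sum_mul,
    ← Finset.mul_sum, Finset.sum_const, Finset.card_univ, hxs, hys, nsmul_eq_mul]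
  ring

end CrossingNumber

/-! ### Bi-invariant vectors and the sum of the crossing transpositions. -/

section PermutationRepresentation

variable {n : Type*} [Fintype n] [DecidableEq n]
variable {E : Type*} [NormedAddCommGroup E] [InnerProductSpace ℂ E]
variable (W : Equiv.Perm (n ⊕ n) →* (E →L[ℂ] E))

/-- The vectors fixed by the permutations which preserve the two summands. -/
def biInvariant : Submodule ℂ E where
  carrier := {Y | ∀ s ∈ (Equiv.Perm.sumCongrHom n n).range, W s Y = Y}
  add_mem' := by
    intro a b ha hb s hs
    rw [map_add, ha s hs, hb s hs]
  zero_mem' := by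
    intro s _
    simp
  smul_mem' := by
    intro c x hx s hs
    rw [map_smul, hx s hs]

/-- The sum of the transpositions which exchange an element of the left summand and one of the
right summand. -/
def crossSum : E →L[ℂ] E := ∑ i : n, ∑ j : n, W (Equiv.swap (Sum.inl i) (Sum.inr j))

variable {W}

omit [Fintype n] [DecidableEq n] in
theorem isClosed_biInvariant : IsClosed (biInvariant W : Set E) := by
  have : (biInvariant W : Set E) =
      ⋂ s ∈ (Equiv.Perm.sumCongrHom n n).range, {Y | W s Y = Y} := by
    ext Y
    simp only [Set.mem_iInter]
    rfl
  rw [this]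
  exact isClosed_biInter fun s _ => isClosed_eq (by fun_prop) (by fun_prop)

omit [Fintype n] [DecidableEq n] in
theorem map_mul_apply (π σ : Equiv.Perm (n ⊕ n)) (x : E) : W (π * σ) x = W π (W σ x) := by
  rw [map_mul]
  rfl

/-- Conjugation by a block permutation permutes the crossing transpositions among themselves. -/
theorem crossSum_mem {Y : E} (hY : Y ∈ biInvariant W) : crossSum W Y ∈ biInvariant W := by
  rintro _ ⟨⟨σ, τ⟩, rfl⟩
  have h : ∀ i j, W (Equiv.Perm.sumCongrHom n n (σ, τ))
      (W (Equiv.swap (Sum.inl i) (Sum.inr j)) Y) =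
      W (Equiv.swap (Sum.inl (σ i)) (Sum.inr (τ j))) Y := by
    intro i j
    have h1 : Equiv.Perm.sumCongrHom n n (σ, τ) * Equiv.swap (Sum.inl i) (Sum.inr j) =
        Equiv.swap (Sum.inl (σ i)) (Sum.inr (τ j)) * Equiv.Perm.sumCongrHom n n (σ, τ) := by
      rw [Equiv.mul_swap_eq_swap_mul]
      rfl
    have h2 := congrArg (fun s => W s Y) h1
    simp only [map_mul_apply] at h2
    rw [h2, hY _ ⟨(σ, τ), rfl⟩]
  simp only [crossSum, sum_apply, map_sum, h]
  rw [Equiv.sum_comp σ fun i => ∑ j, W (Equiv.swap (Sum.inl i) (Sum.inr (τ j))) Y]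
  refine Finset.sum_congr rfl fun i _ => ?_
  rw [Equiv.sum_comp τ fun j => W (Equiv.swap (Sum.inl i) (Sum.inr j)) Y]


omit [Fintype n] in
theorem inner_swap_left (hW : ∀ π x y, ⟪W π x, W π y⟫_ℂ = ⟪x, y⟫_ℂ)
    (a b : n ⊕ n) (x y : E) :
    ⟪W (Equiv.swap a b) x, y⟫_ℂ = ⟪x, W (Equiv.swap a b) y⟫_ℂ := by
  rw [← hW (Equiv.swap a b), ← map_mul_apply, Equiv.swap_mul_self,
    map_one]
  rfl

theorem inner_crossSum_left (hW : ∀ π x y, ⟪W π x, W π y⟫_ℂ = ⟪x, y⟫_ℂ)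
    (x y : E) : ⟪crossSum W x, y⟫_ℂ = ⟪x, crossSum W y⟫_ℂ := by
  simp only [crossSum, sum_apply, sum_inner, inner_sum, inner_swap_left hW]

omit [DecidableEq n] in
theorem inner_apply_eq_of_crossing_eq (hW : ∀ π x y, ⟪W π x, W π y⟫_ℂ = ⟪x, y⟫_ℂ)
    {X Y : E} (hX : X ∈ biInvariant W) (hY : Y ∈ biInvariant W)
    {π π' : Equiv.Perm (n ⊕ n)} (h : crossing π = crossing π') :
    ⟪Y, W π' X⟫_ℂ = ⟪Y, W π X⟫_ℂ := by
  obtain ⟨s, hs, t, ht, rfl⟩ := exists_eq_mul_mul_of_crossing_eq h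
  rw [map_mul_apply, map_mul_apply, hX t ht]
  nth_rw 1 [← hY s hs]
  exact hW _ _ _

omit [DecidableEq n] in
theorem exists_inner_apply_eq (hW : ∀ π x y, ⟪W π x, W π y⟫_ℂ = ⟪x, y⟫_ℂ)
    {X Y : E} (hX : X ∈ biInvariant W) (hY : Y ∈ biInvariant W) :
    ∃ f : ℕ → ℂ, ∀ π, ⟪Y, W π X⟫_ℂ = f (crossing π) := by
  have hf : Function.FactorsThrough (fun π => ⟪Y, W π X⟫_ℂ) (crossing (n := n)) :=
    fun π π' h => inner_apply_eq_of_crossing_eq hW hX hY h.symm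
  exact ⟨Function.extend crossing (fun π => ⟪Y, W π X⟫_ℂ) 0, fun π => (hf.extend_apply _ π).symm⟩

theorem inner_crossSum_left_apply (hW : ∀ π x y, ⟪W π x, W π y⟫_ℂ = ⟪x, y⟫_ℂ)
    (Y X : E) (π : Equiv.Perm (n ⊕ n)) :
    ⟪crossSum W Y, W π X⟫_ℂ =
      ∑ i, ∑ j, ⟪Y, W (Equiv.swap (Sum.inl i) (Sum.inr j) * π) X⟫_ℂ := by
  simp only [crossSum, sum_apply, sum_inner, inner_swap_left hW, map_mul_apply]

/-- The operator `1 + ∑ᵢ (i j)` is `card n + 1` times a projection on bi-invariant vectors. -/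
theorem add_sum_swap_nonneg (hW : ∀ π x y, ⟪W π x, W π y⟫_ℂ = ⟪x, y⟫_ℂ)
    {Y : E} (hY : Y ∈ biInvariant W) (j : n) :
    0 ≤ (⟪Y, Y + ∑ i, W (Equiv.swap (Sum.inl i) (Sum.inr j)) Y⟫_ℂ).re := by
  set A : E →L[ℂ] E := 1 + ∑ i, W (Equiv.swap (Sum.inl i) (Sum.inr j)) with hA
  have hsymm : ∀ x y, ⟪A x, y⟫_ℂ = ⟪x, A y⟫_ℂ := by
    intro x y
    simp only [hA, add_apply, one_apply_eq_self,
      sum_apply, inner_add_left, inner_add_right, sum_inner, inner_sum,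
      inner_swap_left hW]
  have hYA : Y + ∑ i, W (Equiv.swap (Sum.inl i) (Sum.inr j)) Y = A Y := by simp [hA]
  -- For `l ≠ i`, `(l j)(i j) = (i j)(l i)`, and `(l i)` fixes `Y`; for `l = i` the product is the
  -- identity.
  have hswap : ∀ i, A (W (Equiv.swap (Sum.inl i) (Sum.inr j)) Y) =
      Y + (Fintype.card n : ℂ) • W (Equiv.swap (Sum.inl i) (Sum.inr j)) Y := by
    intro i
    have hl : ∀ l ∈ Finset.univ.erase i, W (Equiv.swap (Sum.inl l) (Sum.inr j))
        (W (Equiv.swap (Sum.inl i) (Sum.inr j)) Y) =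
        W (Equiv.swap (Sum.inl i) (Sum.inr j)) Y := by
      intro l hl
      have hs : Equiv.swap (Sum.inl l) (Sum.inl i) ∈ (Equiv.Perm.sumCongrHom n n).range := by
        refine ⟨(Equiv.swap l i, 1), ?_⟩
        rw [Equiv.Perm.sumCongrHom_apply, Equiv.Perm.sumCongr_swap_one]
      rw [← map_mul_apply, Equiv.swap_mul_eq_mul_swap, Equiv.swap_inv,
        Equiv.swap_apply_right,
        Equiv.swap_apply_of_ne_of_ne (by simpa using Finset.ne_of_mem_erase hl) (by simp), 
        map_mul_apply, hY _ hs]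
    have h1 : A (W (Equiv.swap (Sum.inl i) (Sum.inr j)) Y) =
        W (Equiv.swap (Sum.inl i) (Sum.inr j)) Y +
        ∑ l, W (Equiv.swap (Sum.inl l) (Sum.inr j))
          (W (Equiv.swap (Sum.inl i) (Sum.inr j)) Y) := by
      simp [hA]
    have hii : W (Equiv.swap (Sum.inl i) (Sum.inr j))
        (W (Equiv.swap (Sum.inl i) (Sum.inr j)) Y) = Y := by
      rw [← map_mul_apply, Equiv.swap_mul_self, map_one]
      rfl
    rw [h1, ← Finset.add_sum_erase _ _ (Finset.mem_univ i), Finset.sum_congr rfl hl, hii,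
      Finset.sum_const, add_left_comm, ← succ_nsmul',
      Finset.card_erase_add_one (Finset.mem_univ i), Finset.card_univ, Nat.cast_smul_eq_nsmul]
  -- The identity and the `(i j)` represent the cosets of the permutations of the left summand in
  -- those of the left summand together with `j`. So `A` symmetrises `Y` up to the factor `card n +
  -- 1`, and positivity follows from `‖A Y‖² = (card n + 1) ⟪Y, A Y⟫`.
  have hAA : A (A Y) = ((Fintype.card n : ℂ) + 1) • A Y := by
    conv_lhs => rw [← hYA]
    rw [map_add, map_sum, Finset.sum_congr rfl fun i _ => hswap i, Finset.sum_add_distrib,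
      ← Finset.smul_sum, Finset.sum_const, Finset.card_univ, ← Nat.cast_smul_eq_nsmul ℂ,
      ← smul_add, hYA, add_smul, one_smul, add_comm]
  have h2 : ⟪A Y, A Y⟫_ℂ = ((Fintype.card n : ℂ) + 1) * ⟪Y, A Y⟫_ℂ := by
    rw [hsymm, hAA, inner_smul_right]
  have h3 := congrArg Complex.re h2
  have h4 : (⟪A Y, A Y⟫_ℂ).re = ‖A Y‖ ^ 2 := by
    rw [inner_self_eq_norm_sq_to_K]
    norm_cast
  have h5 : (((Fintype.card n : ℂ) + 1) * ⟪Y, A Y⟫_ℂ).re =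
      ((Fintype.card n : ℝ) + 1) * (⟪Y, A Y⟫_ℂ).re := by
    rw [show ((Fintype.card n : ℂ) + 1) = (((Fintype.card n : ℝ) + 1 : ℝ) : ℂ) by push_cast; rfl,
      Complex.re_ofReal_mul]
  rw [h4, h5] at h3
  rw [hYA]
  by_contra hneg
  push Not at hneg
  have : ((Fintype.card n : ℝ) + 1) * (⟪Y, A Y⟫_ℂ).re < 0 :=
    mul_neg_of_pos_of_neg (by positivity) hneg
  nlinarith [sq_nonneg ‖A Y‖]

theorem card_add_crossSum_nonneg (hW : ∀ π x y, ⟪W π x, W π y⟫_ℂ = ⟪x, y⟫_ℂ)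
    {Y : E} (hY : Y ∈ biInvariant W) :
    0 ≤ (⟪Y, (Fintype.card n : ℂ) • Y + crossSum W Y⟫_ℂ).re := by
  have h : (Fintype.card n : ℂ) • Y + crossSum W Y =
      ∑ j, (Y + ∑ i, W (Equiv.swap (Sum.inl i) (Sum.inr j)) Y) := by
    simp only [crossSum, sum_apply]
    rw [Finset.sum_comm, Finset.sum_add_distrib, Finset.sum_const, Finset.card_univ,
      Nat.cast_smul_eq_nsmul]
  rw [h, inner_sum, Complex.re_sum]
  exact Finset.sum_nonneg fun j _ => add_sum_swap_nonneg hW hY j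

end PermutationRepresentation

/-! ### Bounds on the recursive polynomials, uniform in `N`. -/

section CrossingPolynomial

open Polynomial

/-- The polynomials, rescaled dual Hahn polynomials up to signs, which express the expectation of a
permutation with a given crossing number through the sum of the crossing transpositions. -/
def crossPoly (N : ℝ) : ℕ → ℝ[X]
  | 0 => 1
  | 1 => X - 1
  | k + 2 => C (((1 - (k + 1) / N) ^ 2)⁻¹) *
      ((X - C (1 + 2 * (k + 1) * (1 - (k + 1) / N))) * crossPoly N (k + 1) -
        C (((k : ℝ) + 1) ^ 2) * crossPoly N k)

/-- Uniformly in `N ≥ 2 k`, the leading term of `crossPoly N k` dominates. -/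
theorem exists_crossPoly_bound (k : ℕ) :
    ∃ A B : ℝ, 0 ≤ A ∧ 0 ≤ B ∧ ∀ N : ℝ, 0 < N → 2 * k ≤ N → ∀ v : ℝ, 0 ≤ v →
      (∃ c : ℝ, 1 ≤ c ∧ c ≤ 4 ^ k ∧
        |(crossPoly N k).eval v - c * v ^ k| * (1 + v) ≤ A * (1 + v) ^ k) ∧
      |(crossPoly N k).eval v| ≤ B * (1 + v) ^ k := by
  induction k using Nat.twoStepInduction with
  | zero =>
    -- The factor `1 + v` in the bound expresses a remainder of degree `k - 1` without truncated
    -- subtraction; for `k = 0` the remainder vanishes, hence `A = 0`.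
    exact ⟨0, 1, le_rfl, zero_le_one, fun N _ _ v _ =>
      ⟨⟨1, le_rfl, by simp, by simp [crossPoly]⟩, by simp [crossPoly]⟩⟩
  | one =>
    refine ⟨1, 1, zero_le_one, zero_le_one, fun N _ _ v hv =>
      ⟨⟨1, le_rfl, by norm_num, by simp [crossPoly]⟩, ?_⟩⟩
    simp only [crossPoly, eval_sub, eval_X, eval_one, pow_one, one_mul]
    rw [abs_le]
    constructor <;> linarith
  | more k ih₀ ih₁ =>
    obtain ⟨A₀, B₀, hA₀, hB₀, h₀⟩ := ih₀
    obtain ⟨A₁, B₁, hA₁, hB₁, h₁⟩ := ih₁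
    -- The `4` bounds `(1 - (k + 1) / N)⁻²` and `2 k + 3` bounds the middle coefficient of the
    -- recursion, both because `(k + 1) / N ≤ 1 / 2`.
    set A : ℝ := 4 * (A₁ + (2 * k + 3) * B₁ + (k + 1) ^ 2 * B₀) with hA
    have hA0 : 0 ≤ A := by positivity
    refine ⟨A, A + 4 ^ (k + 2), hA0, by positivity, fun N hN hkN v hv => ?_⟩
    push_cast at hkN h₁
    obtain ⟨-, hP₀⟩ := h₀ N hN (by linarith) v hv
    obtain ⟨⟨c, hc1, hc4, hR⟩, hP₁⟩ := h₁ N hN (by linarith) v hv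
    set e : ℝ := 1 - (k + 1) / N with he
    have hk0 : (0 : ℝ) ≤ k := k.cast_nonneg
    have he1 : e ≤ 1 := by
      have : (0 : ℝ) ≤ (k + 1) / N := by positivity
      linarith
    have he2 : 1 / 2 ≤ e := by
      have : ((k : ℝ) + 1) / N ≤ 1 / 2 := by
        rw [div_le_div_iff₀ hN two_pos]
        linarith
      linarith
    have hs0 : 0 ≤ 1 + 2 * (k + 1) * e := by positivity
    have hs : 1 + 2 * (k + 1) * e ≤ 2 * k + 3 := by nlinarith
    set d : ℝ := (e ^ 2)⁻¹ with hd
    have hd1 : 1 ≤ d := by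
      rw [hd, one_le_inv₀ (by positivity)]
      nlinarith
    have hd4 : d ≤ 4 := by
      rw [hd, inv_le_comm₀ (by positivity) (by norm_num)]
      nlinarith
    set p₀ := (crossPoly N k).eval v with hp₀
    set p₁ := (crossPoly N (k + 1)).eval v with hp₁
    have hp₂ : (crossPoly N (k + 2)).eval v =
        d * ((v - (1 + 2 * (k + 1) * e)) * p₁ - (k + 1) ^ 2 * p₀) := by
      simp only [crossPoly, eval_mul, eval_sub, eval_C, eval_X, hp₀, hp₁, hd, he]
    have hw : (1 : ℝ) ≤ 1 + v := by linarith
    set w : ℝ := 1 + v with hwdef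
    have hw0 : 0 ≤ w := by linarith
    have t1 : v * (|p₁ - c * v ^ (k + 1)| * w) ≤ A₁ * w ^ (k + 2) := by
      calc v * (|p₁ - c * v ^ (k + 1)| * w) ≤ w * (A₁ * w ^ (k + 1)) := by
            gcongr
            linarith
        _ = A₁ * w ^ (k + 2) := by ring
    have t2 : (1 + 2 * (k + 1) * e) * (w * |p₁|) ≤ (2 * k + 3) * B₁ * w ^ (k + 2) := by
      calc (1 + 2 * (k + 1) * e) * (w * |p₁|) ≤ (2 * k + 3) * (w * (B₁ * w ^ (k + 1))) := by
            refine mul_le_mul hs ?_ (by positivity) (by positivity)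
            gcongr
        _ = (2 * k + 3) * B₁ * w ^ (k + 2) := by ring
    have t3 : ((k : ℝ) + 1) ^ 2 * (w * |p₀|) ≤ (k + 1) ^ 2 * B₀ * w ^ (k + 2) := by
      calc ((k : ℝ) + 1) ^ 2 * (w * |p₀|) ≤ (k + 1) ^ 2 * (w * (B₀ * w ^ k)) := by gcongr
        _ = (k + 1) ^ 2 * B₀ * w ^ (k + 1) := by ring
        _ ≤ (k + 1) ^ 2 * B₀ * w ^ (k + 2) := by
            gcongr 2
            omega
    have hmain : |(crossPoly N (k + 2)).eval v - d * c * v ^ (k + 2)| * w ≤ A * w ^ (k + 2) := by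
      have hid : (crossPoly N (k + 2)).eval v - d * c * v ^ (k + 2) =
          d * (v * (p₁ - c * v ^ (k + 1)) - (1 + 2 * (k + 1) * e) * p₁ - (k + 1) ^ 2 * p₀) := by
        rw [hp₂]
        ring
      have habs : |v * (p₁ - c * v ^ (k + 1)) - (1 + 2 * (k + 1) * e) * p₁ - (k + 1) ^ 2 * p₀| ≤
          v * |p₁ - c * v ^ (k + 1)| + (1 + 2 * (k + 1) * e) * |p₁| + (k + 1) ^ 2 * |p₀| := by
        refine (abs_sub _ _).trans ?_
        refine add_le_add ((abs_sub _ _).trans ?_) ?_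
        · rw [abs_mul, abs_mul, abs_of_nonneg hv, abs_of_nonneg hs0]
        · rw [abs_mul, abs_of_nonneg (by positivity)]
      rw [hid, abs_mul, abs_of_nonneg (by linarith), mul_assoc]
      calc d * (|_| * w) ≤ 4 * ((v * |p₁ - c * v ^ (k + 1)| + (1 + 2 * (k + 1) * e) * |p₁| +
            (k + 1) ^ 2 * |p₀|) * w) := by gcongr
        _ = 4 * (v * (|p₁ - c * v ^ (k + 1)| * w) + (1 + 2 * (k + 1) * e) * (w * |p₁|) +
            (k + 1) ^ 2 * (w * |p₀|)) := by ring
        _ ≤ 4 * (A₁ * w ^ (k + 2) + (2 * k + 3) * B₁ * w ^ (k + 2) +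
            (k + 1) ^ 2 * B₀ * w ^ (k + 2)) := by gcongr
        _ = A * w ^ (k + 2) := by rw [hA]; ring
    have hdc : d * c ≤ 4 ^ (k + 2) := by
      calc d * c ≤ 4 * 4 ^ (k + 1) := by gcongr
        _ = 4 ^ (k + 2) := by ring
    refine ⟨⟨d * c, one_le_mul_of_one_le_of_one_le hd1 hc1, hdc, hmain⟩, ?_⟩
    set q := (crossPoly N (k + 2)).eval v
    calc |q| = |(q - d * c * v ^ (k + 2)) + d * c * v ^ (k + 2)| := by ring_nf
      _ ≤ |q - d * c * v ^ (k + 2)| + |d * c * v ^ (k + 2)| := abs_add_le _ _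
      _ ≤ |q - d * c * v ^ (k + 2)| * w + 4 ^ (k + 2) * w ^ (k + 2) := by
          rw [abs_of_nonneg (by positivity : 0 ≤ d * c * v ^ (k + 2))]
          gcongr
          · exact le_mul_of_one_le_right (abs_nonneg _) hw
          · linarith
      _ ≤ (A + 4 ^ (k + 2)) * w ^ (k + 2) := by
          rw [add_mul]
          gcongr

theorem exists_mul_pow_sub_pow_le (M : ℝ) (m : ℕ) :
    ∃ D : ℝ, ∀ v : ℝ, 0 ≤ v → M * (1 + v) ^ m - v ^ (m + 1) ≤ D := by
  -- Beyond `L` one has `1 + v ≤ 2 v` and `|M| * 2 ^ m ≤ v`, so the higher power dominates.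
  set L : ℝ := max 1 (|M| * 2 ^ m) with hL
  have hL1 : 1 ≤ L := le_max_left _ _
  refine ⟨|M| * (1 + L) ^ m, fun v hv => ?_⟩
  have h0 : M * (1 + v) ^ m ≤ |M| * (1 + v) ^ m := by
    gcongr
    exact le_abs_self M
  rcases le_total v L with h | h
  · have h1 : |M| * (1 + v) ^ m ≤ |M| * (1 + L) ^ m := by gcongr
    have h2 : 0 ≤ v ^ (m + 1) := by positivity
    linarith
  · have h1 : |M| * (1 + v) ^ m ≤ v ^ (m + 1) := by
      calc |M| * (1 + v) ^ m ≤ |M| * (2 * v) ^ m := by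
            gcongr
            linarith
        _ = |M| * 2 ^ m * v ^ m := by ring
        _ ≤ v * v ^ m := by
            gcongr
            exact (le_max_right _ _).trans h
        _ = v ^ (m + 1) := by ring
    have h2 : 0 ≤ |M| * (1 + L) ^ m := by positivity
    linarith

/-- The leading term of `crossPoly N (m + 1)` is at least `v ^ (m + 1)`; its remainder and
`crossPoly N k` are both of order `(1 + v) ^ m`, with constants independent of `N`. -/
theorem exists_abs_crossPoly_le {k m : ℕ} (hkm : k ≤ m) :
    ∃ D : ℝ, ∀ N : ℝ, 2 * (m + 1 : ℕ) ≤ N → ∀ v : ℝ, 0 ≤ v →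
      |(crossPoly N k).eval v| ≤ D + (crossPoly N (m + 1)).eval v := by
  obtain ⟨_, B, -, hB, hk⟩ := exists_crossPoly_bound k
  obtain ⟨A, _, hA, -, hm⟩ := exists_crossPoly_bound (m + 1)
  obtain ⟨D, hD⟩ := exists_mul_pow_sub_pow_le (B + A) m
  refine ⟨D, fun N hN v hv => ?_⟩
  have hN0 : 0 < N := by
    push_cast at hN
    have : (0 : ℝ) ≤ m := m.cast_nonneg
    linarith
  have hkN : 2 * (k : ℝ) ≤ N := by
    have : (k : ℝ) ≤ (m + 1 : ℕ) := by exact_mod_cast hkm.trans m.le_succ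
    linarith
  obtain ⟨-, h1⟩ := hk N hN0 hkN v hv
  obtain ⟨⟨c, hc, -, h2⟩, -⟩ := hm N hN0 hN v hv
  have h3 : B * (1 + v) ^ k ≤ B * (1 + v) ^ m := by
    gcongr
    linarith
  have h4 : |(crossPoly N (m + 1)).eval v - c * v ^ (m + 1)| ≤ A * (1 + v) ^ m := by
    rw [pow_succ (1 + v), ← mul_assoc] at h2
    exact le_of_mul_le_mul_right h2 (by linarith)
  have h5 : v ^ (m + 1) ≤ c * v ^ (m + 1) := le_mul_of_one_le_left (by positivity) hc
  have h6 := (abs_le.1 h4).1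
  have h7 := hD v hv
  rw [add_mul] at h7
  linarith

end CrossingPolynomial

/-! ### Functional calculus of the positive operator `crossOp`. -/

section Spectral

open Polynomial

variable {n : Type*} [Fintype n] [DecidableEq n]
variable {E : Type*} [NormedAddCommGroup E] [InnerProductSpace ℂ E]

theorem algebraMap_real_apply {F : Type*} [NormedAddCommGroup F] [InnerProductSpace ℂ F] (r : ℝ)
    (x : F) : algebraMap ℝ (F →L[ℂ] F) r x = (r : ℂ) • x := by
  rw [Algebra.algebraMap_eq_smul_one, Complex.coe_smul]
  rfl

theorem algebraMap_real_mul_apply {F : Type*} [NormedAddCommGroup F] [InnerProductSpace ℂ F]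
    (r : ℝ) (T : F →L[ℂ] F) (x : F) :
    (algebraMap ℝ (F →L[ℂ] F) r * T) x = (r : ℂ) • T x :=
  algebraMap_real_apply r (T x)

theorem aeval_inner_nonneg {F : Type*} [NormedAddCommGroup F] [InnerProductSpace ℂ F]
    [CompleteSpace F] {a : F →L[ℂ] F} (ha : 0 ≤ a) {q : ℝ[X]} (hq : ∀ v : ℝ, 0 ≤ v → 0 ≤ q.eval v)
    (x : F) : 0 ≤ (⟪x, aeval a q x⟫_ℂ).re := by
  have h1 : 0 ≤ aeval a q := by
    rw [← cfc_polynomial q a (IsSelfAdjoint.of_nonneg ha)]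
    exact cfc_nonneg fun v hv => hq v (spectrum_nonneg_of_nonneg ha hv)
  exact ((ContinuousLinearMap.nonneg_iff_isPositive _).1 h1).re_inner_nonneg_right x

/-- The sum of the crossing transpositions on the bi-invariant vectors, rescaled to be positive. -/
def crossOp (W : Equiv.Perm (n ⊕ n) →* (E →L[ℂ] E)) : biInvariant W →L[ℂ] biInvariant W :=
  1 + (Fintype.card n : ℂ)⁻¹ • ((crossSum W).comp (biInvariant W).subtypeL).codRestrict
    (biInvariant W) fun Y => crossSum_mem Y.2

theorem coe_crossOp_apply (W : Equiv.Perm (n ⊕ n) →* (E →L[ℂ] E)) (Y : biInvariant W) :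
    (crossOp W Y : E) = Y + (Fintype.card n : ℂ)⁻¹ • crossSum W Y := rfl

variable {W : Equiv.Perm (n ⊕ n) →* (E →L[ℂ] E)}

theorem inner_crossOp_left (hW : ∀ π x y, ⟪W π x, W π y⟫_ℂ = ⟪x, y⟫_ℂ) (Y Z : biInvariant W) :
    ⟪crossOp W Y, Z⟫_ℂ = ⟪Y, crossOp W Z⟫_ℂ := by
  simp only [Submodule.coe_inner, coe_crossOp_apply, inner_add_left, inner_add_right,
    inner_smul_left, inner_smul_right, inner_crossSum_left hW, map_inv₀, map_natCast]

/-- Up to the factor `card n` this is `card_add_crossSum_nonneg`. It confines the spectrum to `[0,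
∞)`, where the polynomial inequalities hold. -/
theorem crossOp_nonneg [Nonempty n] [CompleteSpace (biInvariant W)]
    (hW : ∀ π x y, ⟪W π x, W π y⟫_ℂ = ⟪x, y⟫_ℂ) : 0 ≤ crossOp W := by
  rw [ContinuousLinearMap.nonneg_iff_isPositive, ContinuousLinearMap.isPositive_def]
  refine ⟨fun Y Z => inner_crossOp_left hW Y Z, fun Y => ?_⟩
  have h1 : (Fintype.card n : ℂ) ≠ 0 := by simp
  have h2 : ⟪crossOp W Y, Y⟫_ℂ = ((Fintype.card n : ℝ)⁻¹ : ℝ) *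
      ⟪(Y : E), (Fintype.card n : ℂ) • (Y : E) + crossSum W Y⟫_ℂ := by
    rw [inner_crossOp_left hW, Submodule.coe_inner, coe_crossOp_apply, inner_add_right,
      inner_add_right, inner_smul_right, inner_smul_right]
    push_cast
    field_simp
  rw [ContinuousLinearMap.reApplyInnerSelf_apply, h2]
  change 0 ≤ (_ : ℂ).re
  rw [Complex.re_ofReal_mul]
  exact mul_nonneg (by positivity) (card_add_crossSum_nonneg hW Y.2)

/-- Averaging `⟪Y, W π X⟫` over left multiplications of `π` by crossing transpositions gives a
three-term recursion in the crossing number. Multiplied by the powers of `card n`, it is the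
recursion defining `crossPoly`. -/
theorem card_pow_mul_inner_eq (hW : ∀ π x y, ⟪W π x, W π y⟫_ℂ = ⟪x, y⟫_ℂ) (X : biInvariant W)
    (k : ℕ) (hk : k ≤ Fintype.card n) (Y : biInvariant W) (π : Equiv.Perm (n ⊕ n))
    (hπ : crossing π = k) :
    (Fintype.card n : ℂ) ^ k * ⟪(Y : E), W π X⟫_ℂ =
      ⟪Y, aeval (crossOp W) (crossPoly (Fintype.card n) k) X⟫_ℂ := by
  have hone : ∀ Y : biInvariant W, ∀ π : Equiv.Perm (n ⊕ n), crossing π = 0 →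
      ⟪(Y : E), W π X⟫_ℂ = ⟪(Y : E), X⟫_ℂ := by
    intro Y π hπ
    have h1 : crossing (1 : Equiv.Perm (n ⊕ n)) = 0 := by simp [crossing]
    rw [inner_apply_eq_of_crossing_eq hW X.2 Y.2 (h1.trans hπ.symm), map_one]
    rfl
  -- The truncated `m - 1` at `m = 0` and the value at `m + 1` for `m = card n` are harmless, as
  -- their coefficients vanish.
  have hstep : ∀ (f g : ℕ → ℂ) (Y : biInvariant W), (∀ π, ⟪(Y : E), W π X⟫_ℂ = f (crossing π)) →
      (∀ π, ⟪(crossOp W Y : E), W π X⟫_ℂ = g (crossing π)) → ∀ m ≤ Fintype.card n,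
      g m = f m + (Fintype.card n : ℂ)⁻¹ * (((Fintype.card n : ℂ) - m) ^ 2 * f (m + 1) +
        2 * m * ((Fintype.card n : ℂ) - m) * f m + (m : ℂ) ^ 2 * f (m - 1)) := by
    intro f g Y hf hg m hm
    obtain ⟨π, rfl⟩ := exists_crossing_eq hm
    rw [← hg, coe_crossOp_apply, inner_add_left, inner_smul_left, inner_crossSum_left_apply hW, hf]
    simp only [hf, sum_crossing_swap_mul, map_inv₀, map_natCast]
  -- `Y` is generalised because the induction hypothesis is also applied to `crossOp W Y`.
  induction k using Nat.twoStepInduction generalizing Y π with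
  | zero => simp [crossPoly, hone Y π hπ]
  | one =>
    obtain ⟨f, hf⟩ := exists_inner_apply_eq hW X.2 Y.2
    obtain ⟨g, hg⟩ := exists_inner_apply_eq hW X.2 (crossOp W Y).2
    have hs := hstep f g Y hf hg 0 (Nat.zero_le _)
    have h0 : (Fintype.card n : ℂ) ≠ 0 := by
      rw [Nat.cast_ne_zero]
      omega
    have h1 : crossing (1 : Equiv.Perm (n ⊕ n)) = 0 := by simp [crossing]
    have e1 := hf 1
    have e2 := hg 1
    rw [hone _ _ h1, h1] at e1 e2
    have e3 : ⟪Y, aeval (crossOp W) (crossPoly (Fintype.card n) 1) X⟫_ℂ = g 0 - f 0 := by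
      simp only [crossPoly, map_sub, aeval_X, map_one, sub_apply,
        one_apply_eq_self, inner_sub_right, ← inner_crossOp_left hW, Submodule.coe_inner, e1, e2]
    rw [e3, hs, hf, hπ]
    push_cast
    field_simp
    ring
  | more k ih₀ ih₁ =>
    obtain ⟨f, hf⟩ := exists_inner_apply_eq hW X.2 Y.2
    obtain ⟨g, hg⟩ := exists_inner_apply_eq hW X.2 (crossOp W Y).2
    have hs := hstep f g Y hf hg (k + 1) (by omega)
    obtain ⟨π₀, hπ₀⟩ := exists_crossing_eq (n := n) (k := k) (by omega)
    obtain ⟨π₁, hπ₁⟩ := exists_crossing_eq (n := n) (k := k + 1) (by omega)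
    have e0 := ih₀ (by omega) Y π₀ hπ₀
    have e1 := ih₁ (by omega) Y π₁ hπ₁
    have e2 := ih₁ (by omega) (crossOp W Y) π₁ hπ₁
    rw [hf, hπ₀] at e0
    rw [hf, hπ₁] at e1
    rw [hg, hπ₁] at e2
    have h0 : (Fintype.card n : ℂ) ≠ 0 := by
      rw [Nat.cast_ne_zero]
      omega
    have h1 : (Fintype.card n : ℂ) - (k + 1) ≠ 0 := by
      rw [sub_ne_zero]
      exact_mod_cast (show Fintype.card n ≠ k + 1 by omega)
    have e3 : ⟪Y, aeval (crossOp W) (crossPoly (Fintype.card n) (k + 2)) X⟫_ℂ =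
        ((1 - ((k : ℂ) + 1) / Fintype.card n) ^ 2)⁻¹ *
        ((Fintype.card n : ℂ) ^ (k + 1) * g (k + 1) -
        (1 + 2 * (k + 1) * (1 - (k + 1) / Fintype.card n)) *
          ((Fintype.card n : ℂ) ^ (k + 1) * f (k + 1)) -
        (k + 1) ^ 2 * ((Fintype.card n : ℂ) ^ k * f k)) := by
      rw [e0, e1, e2, inner_crossOp_left hW]
      have hmul : ∀ T : biInvariant W →L[ℂ] biInvariant W, (crossOp W * T) X = crossOp W (T X) :=
        fun _ => rfl
      simp only [crossPoly, map_mul, map_sub, aeval_X,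
        aeval_C, sub_mul, algebraMap_real_mul_apply, sub_apply, inner_sub_right, inner_smul_right,
        hmul]
      push_cast
      ring
    rw [e3, hs, hf, hπ]
    have h2 : (1 : ℂ) - ((k : ℂ) + 1) / Fintype.card n =
        ((Fintype.card n : ℂ) - (k + 1)) / Fintype.card n := by field_simp
    rw [h2]
    simp only [Nat.add_sub_cancel]
    push_cast
    field_simp
    ring

/-- If the odd coefficient of order `m + 1` has the right sign, then the coefficients of lower order
decay. -/
theorem card_pow_mul_abs_inner_le [Nonempty n] [CompleteSpace E]
    (hW : ∀ π x y, ⟪W π x, W π y⟫_ℂ = ⟪x, y⟫_ℂ)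
    {X : E} (hX : X ∈ biInvariant W) (hX1 : ‖X‖ = 1) {k m : ℕ} {D : ℝ}
    (hD : ∀ v : ℝ, 0 ≤ v → |(crossPoly (Fintype.card n) k).eval v| ≤
      D + (crossPoly (Fintype.card n) (m + 1)).eval v)
    (hm : m + 1 ≤ Fintype.card n) {π π' : Equiv.Perm (n ⊕ n)} (hπ : crossing π = k)
    (hπ' : crossing π' = m + 1) (hneg : (⟪X, W π' X⟫_ℂ).re ≤ 0) (hk : k ≤ Fintype.card n) :
    (Fintype.card n : ℝ) ^ k * |(⟪X, W π X⟫_ℂ).re| ≤ D := by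
  have : CompleteSpace (biInvariant W) := isClosed_biInvariant.completeSpace_coe
  have ha := crossOp_nonneg hW
  lift X to biInvariant W using hX
  have h1 := congrArg Complex.re (card_pow_mul_inner_eq hW X k hk X π hπ)
  have h2 := congrArg Complex.re (card_pow_mul_inner_eq hW X (m + 1) hm X π' hπ')
  have hc : ∀ j, (Fintype.card n : ℂ) ^ j = (((Fintype.card n : ℝ) ^ j : ℝ) : ℂ) := by
    intro j
    push_cast
    rfl
  rw [hc, Complex.re_ofReal_mul] at h1 h2
  have h3 : (Fintype.card n : ℝ) ^ (m + 1) * (⟪(X : E), W π' X⟫_ℂ).re ≤ 0 :=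
    mul_nonpos_of_nonneg_of_nonpos (by positivity) hneg
  have hXX : (⟪X, algebraMap ℝ (biInvariant W →L[ℂ] biInvariant W) D X⟫_ℂ).re = D := by
    rw [algebraMap_real_apply, inner_smul_right, Complex.re_ofReal_mul,
      inner_self_eq_norm_sq_to_K, Submodule.coe_norm, hX1]
    simp
  -- The polynomial `D + crossPoly (m + 1) - s * crossPoly k` is nonnegative on `[0, ∞)`, and the
  -- expectation of its middle term is at most `0` by `hneg`.
  have key : ∀ s : ℝ, |s| = 1 →
      s * ((Fintype.card n : ℝ) ^ k * (⟪(X : E), W π X⟫_ℂ).re) ≤ D := by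
    intro s hs
    have := aeval_inner_nonneg ha (q := C D + crossPoly (Fintype.card n) (m + 1) -
      C s * crossPoly (Fintype.card n) k) (fun v hv => by
        have h4 := hD v hv
        have h5 := le_abs_self (s * (crossPoly (Fintype.card n) k).eval v)
        rw [abs_mul, hs, one_mul] at h5
        simp only [eval_sub, eval_add, eval_mul, eval_C]
        linarith) X
    simp only [map_sub, map_add, map_mul, aeval_C, sub_apply, add_apply, inner_sub_right,
      inner_add_right, Complex.sub_re, Complex.add_re, hXX, ← h2] at this
    have h6 : (⟪X, (algebraMap ℝ (biInvariant W →L[ℂ] biInvariant W) s *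
        aeval (crossOp W) (crossPoly (Fintype.card n) k)) X⟫_ℂ).re =
        s * (⟪X, aeval (crossOp W) (crossPoly (Fintype.card n) k) X⟫_ℂ).re := by
      rw [algebraMap_real_mul_apply, inner_smul_right, Complex.re_ofReal_mul]
    rw [h6, ← h1] at this
    linarith
  rcases abs_cases (⟪(X : E), W π X⟫_ℂ).re with ⟨h, -⟩ | ⟨h, -⟩
  · have := key 1 (by simp)
    rw [h]
    linarith
  · have := key (-1) (by simp)
    rw [h]
    linarith

end Spectral

/-! ### Bases and permutations of tensor powers. -/

section TensorCalculus

variable {ι κ μ ν : Type*} [Fintype ι] [Fintype κ] [Fintype μ] [Fintype ν]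
variable {H : Type*} [NormedAddCommGroup H] [InnerProductSpace ℂ H]

theorem tensorPow_clm_eq {F : Type*} [NormedAddCommGroup F] [NormedSpace ℂ F]
    {f g : TensorPow ι H →L[ℂ] F} (h : ∀ v, f (tprod v) = g (tprod v)) (x : TensorPow ι H) :
    f x = g x := by
  induction x using UniformSpace.Completion.induction_on with
  | hp => exact isClosed_eq (by fun_prop) (by fun_prop)
  | ih x =>
    change f (toTensorPow x) = g (toTensorPow x)
    induction x using algTensor_induction with
    | hs c v =>
      rw [map_smul, map_smul, map_smul]
      exact congrArg (c • ·) (h v)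
    | ha x y hx hy => rw [map_add, map_add, map_add, hx, hy]

theorem dense_span_tprod :
    (Submodule.span ℂ (Set.range (tprod : (ι → H) → TensorPow ι H))).topologicalClosure = ⊤ := by
  rw [eq_top_iff]
  intro x hx
  clear hx
  induction x using UniformSpace.Completion.induction_on with
  | hp => exact (Submodule.span ℂ (Set.range (tprod : (ι → H) → _))).isClosed_topologicalClosure
  | ih x =>
    change toTensorPow x ∈ _
    induction x using algTensor_induction with
    | hs c v =>
      rw [map_smul]
      exact Submodule.smul_mem _ _
        (Submodule.le_topologicalClosure _ (Submodule.subset_span ⟨v, rfl⟩))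
    | ha x y hx hy =>
      rw [map_add]
      exact add_mem hx hy

theorem inner_reindex (e : ι ≃ κ) (x y : TensorPow ι H) :
    ⟪reindex e x, reindex e y⟫_ℂ = ⟪x, y⟫_ℂ := by
  have h : ∀ x : AlgTensor ι H, reindex e (x : TensorPow ι H) =
      ((algReindex e x : AlgTensor κ H) : TensorPow κ H) := by
    intro x
    change reindex e (toTensorPow x) = _
    rw [reindex, ContinuousLinearMap.extend_eq _ denseRange_toTensorPow
      isUniformInducing_toTensorPow]
    rfl
  induction x, y using UniformSpace.Completion.induction_on₂ with
  | hp => exact isClosed_eq (by fun_prop) (by fun_prop)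
  | ih x y => rw [h, h, UniformSpace.Completion.inner_coe, UniformSpace.Completion.inner_coe,
      inner_algReindex]

theorem reindex_trans (e : ι ≃ κ) (f : κ ≃ μ) (x : TensorPow ι H) :
    reindex (e.trans f) x = reindex f (reindex e x) := by
  refine tensorPow_clm_eq (g := (reindex f).comp (reindex e)) (fun v => ?_) x
  simp [reindex_tprod]

theorem reindex_refl (x : TensorPow ι H) : reindex (Equiv.refl ι) x = x := by
  refine tensorPow_clm_eq (g := ContinuousLinearMap.id ℂ _) (fun v => ?_) x
  simp [reindex_tprod]

theorem reindex_tmul (e : ι ≃ μ) (f : κ ≃ ν) (x : TensorPow ι H) (y : TensorPow κ H) :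
    reindex (e.sumCongr f) (tmul x y) = tmul (reindex e x) (reindex f y) := by
  refine tensorPow_clm_eq (f := (reindex (e.sumCongr f)).comp (tmul.flip y))
    (g := (tmul.flip (reindex f y)).comp (reindex e)) (fun v => ?_) x
  refine tensorPow_clm_eq (f := (reindex (e.sumCongr f)).comp (tmul (tprod v)))
    (g := (tmul (reindex e (tprod v))).comp (reindex f)) (fun w => ?_) y
  simp only [ContinuousLinearMap.comp_apply, reindex_tprod, tmul_tprod]
  congr 1
  ext (i | i) <;> rfl

theorem _root_.HilbertBasis.apply_mem_of_forall_mem {γ E F : Type*} [NormedAddCommGroup E]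
    [InnerProductSpace ℂ E] [NormedAddCommGroup F] [NormedSpace ℂ F] (b : HilbertBasis γ ℂ E)
    {S : Submodule ℂ F} (hS : IsClosed (S : Set F)) {T : E →L[ℂ] F} (hT : ∀ i, T (b i) ∈ S)
    (x : E) : T x ∈ S := by
  have h : (Submodule.span ℂ (Set.range b)).topologicalClosure ≤ S.comap T.toLinearMap := by
    refine Submodule.topologicalClosure_minimal _ ?_ (hS.preimage T.continuous)
    rw [Submodule.span_le]
    rintro _ ⟨i, rfl⟩
    exact hT i
  rw [b.dense_span] at h
  exact h (Submodule.mem_top (x := x))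

/-- The elementary tensors of two Hilbert bases form a Hilbert basis. -/
theorem exists_hilbertBasis_tmul {α β : Type*} (b : HilbertBasis α ℂ (TensorPow ι H))
    (b' : HilbertBasis β ℂ (TensorPow κ H)) :
    ∃ B : HilbertBasis (α × β) ℂ (TensorPow (ι ⊕ κ) H),
      ∀ p, B p = tmul (b p.1) (b' p.2) := by
  classical
  have ho : Orthonormal ℂ fun p : α × β => tmul (b p.1) (b' p.2) := by
    rw [orthonormal_iff_ite]
    rintro ⟨i, j⟩ ⟨i', j'⟩
    rw [inner_tmul, orthonormal_iff_ite.1 b.orthonormal, orthonormal_iff_ite.1 b'.orthonormal]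
    by_cases h₁ : i = i' <;> by_cases h₂ : j = j' <;> simp [h₁, h₂]
  set S := (Submodule.span ℂ
    (Set.range fun p : α × β => tmul (b p.1) (b' p.2))).topologicalClosure with hS
  have hSc : IsClosed (S : Set (TensorPow (ι ⊕ κ) H)) := Submodule.isClosed_topologicalClosure _
  have h2 : ∀ x y, tmul x y ∈ S := by
    intro x y
    refine b.apply_mem_of_forall_mem hSc (T := tmul.flip y) (fun i => ?_) x
    refine b'.apply_mem_of_forall_mem hSc (T := tmul (b i)) (fun j => ?_) y
    exact Submodule.le_topologicalClosure _ (Submodule.subset_span ⟨(i, j), rfl⟩)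
  have h3 : ⊤ ≤ S := by
    rw [← dense_span_tprod]
    refine Submodule.topologicalClosure_minimal _ ?_ hSc
    rw [Submodule.span_le]
    rintro _ ⟨v, rfl⟩
    have := h2 (tprod fun i => v (Sum.inl i)) (tprod fun j => v (Sum.inr j))
    rw [tmul_tprod] at this
    have hv : (Sum.elim (fun i => v (Sum.inl i)) fun j => v (Sum.inr j)) = v := by
      ext (i | i) <;> rfl
    rwa [hv] at this
  exact ⟨HilbertBasis.mk ho h3, fun p => congrFun (HilbertBasis.coe_mk ho h3) p⟩

variable (ι κ) in
/-- The exchange of the first parts of two copies of `ι ⊕ κ`. -/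
def pairSwap : Equiv.Perm ((ι ⊕ κ) ⊕ (ι ⊕ κ)) :=
  Function.Involutive.toPerm
    (Sum.elim (Sum.elim (fun i => Sum.inr (Sum.inl i)) (fun j => Sum.inl (Sum.inr j)))
      (Sum.elim (fun i => Sum.inl (Sum.inl i)) (fun j => Sum.inr (Sum.inr j))))
    (by rintro ((i | i) | (i | i)) <;> rfl)

omit [Fintype ι] [Fintype κ] in
@[simp] theorem pairSwap_inl_inl (i : ι) :
    pairSwap ι κ (Sum.inl (Sum.inl i)) = Sum.inr (Sum.inl i) := rfl

omit [Fintype ι] [Fintype κ] in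
@[simp] theorem pairSwap_inl_inr (j : κ) :
    pairSwap ι κ (Sum.inl (Sum.inr j)) = Sum.inl (Sum.inr j) := rfl

omit [Fintype ι] [Fintype κ] in
@[simp] theorem pairSwap_inr_inl (i : ι) :
    pairSwap ι κ (Sum.inr (Sum.inl i)) = Sum.inl (Sum.inl i) := rfl

omit [Fintype ι] [Fintype κ] in
@[simp] theorem pairSwap_inr_inr (j : κ) :
    pairSwap ι κ (Sum.inr (Sum.inr j)) = Sum.inr (Sum.inr j) := rfl

theorem reindex_pairSwap (x x' : TensorPow ι H) (y y' : TensorPow κ H) :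
    reindex (pairSwap ι κ) (tmul (tmul x y) (tmul x' y')) = tmul (tmul x' y) (tmul x y') := by
  refine tensorPow_clm_eq (f := (reindex (pairSwap ι κ)).comp
    ((tmul.flip (tmul x' y')).comp (tmul.flip y)))
    (g := (tmul (tmul x' y)).comp (tmul.flip y')) (fun v => ?_) x
  refine tensorPow_clm_eq (f := (reindex (pairSwap ι κ)).comp
    ((tmul.flip (tmul x' y')).comp (tmul (tprod v))))
    (g := (tmul.flip (tmul (tprod v) y')).comp (tmul x')) (fun w => ?_) y
  refine tensorPow_clm_eq (f := (reindex (pairSwap ι κ)).comp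
    ((tmul (tmul (tprod v) (tprod w))).comp (tmul.flip y')))
    (g := (tmul.flip (tmul (tprod v) y')).comp (tmul.flip (tprod w))) (fun v' => ?_) x'
  refine tensorPow_clm_eq (f := (reindex (pairSwap ι κ)).comp
    ((tmul (tmul (tprod v) (tprod w))).comp (tmul (tprod v'))))
    (g := (tmul (tmul (tprod v') (tprod w))).comp (tmul (tprod v))) (fun w' => ?_) y'
  simp only [ContinuousLinearMap.comp_apply, tmul_tprod, reindex_tprod]
  congr 1
  ext ((i | i) | (i | i)) <;> rfl

/-- An involution whose fixed points are the two copies of `κ` is a product of `card ι`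
transpositions. -/
theorem sign_pairSwap [DecidableEq ι] [DecidableEq κ] :
    Equiv.Perm.sign (pairSwap ι κ) = (-1) ^ Fintype.card ι := by
  have h : (pairSwap ι κ) ^ 2 = 1 := by
    ext ((i | i) | (i | i)) <;> rfl
  have hfix : Function.fixedPoints (pairSwap ι κ) =
      Set.range (Sum.map (Sum.inr : κ → ι ⊕ κ) (Sum.inr : κ → ι ⊕ κ)) := by
    ext ((i | i) | (i | i)) <;> simp [Function.mem_fixedPoints, Function.IsFixedPt]
  have hcard : Fintype.card (Function.fixedPoints (pairSwap ι κ)) =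
      Fintype.card κ + Fintype.card κ := by
    rw [Fintype.card_congr (Equiv.setCongr hfix), Set.card_range_of_injective
      (Sum.inr_injective.sumMap Sum.inr_injective), Fintype.card_sum]
  rw [Equiv.Perm.sign_of_pow_two_eq_one h, hcard]
  simp only [Fintype.card_sum]
  congr 1
  omega

end TensorCalculus

/-! ### Trace and purity of a partial trace. -/

section PartialTrace

variable {ι κ : Type*} [Fintype ι] [Fintype κ]
variable {H : Type*} [NormedAddCommGroup H] [InnerProductSpace ℂ H]
variable (Φ : TensorPow (ι ⊕ κ) H)

theorem hasSum_inner_partialTrace (x y : TensorPow ι H) :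
    HasSum (fun j => ⟪tmul x (stdBasis (TensorPow κ H) j), Φ⟫_ℂ *
        ⟪Φ, tmul y (stdBasis (TensorPow κ H) j)⟫_ℂ)
      ⟪x, partialTrace (InnerProductSpace.rankOne ℂ Φ Φ) y⟫_ℂ := by
  have h := (hasSum_partialTrace (ι := ι) Φ).mapL
    ((innerSL ℂ x).comp (ContinuousLinearMap.apply ℂ (TensorPow ι H) y))
  refine Eq.mpr (congrArg (fun f => HasSum f _) (funext fun j => ?_)) h
  change _ = ⟪x, (tensorRight (stdBasis (TensorPow κ H) j)).adjoint
    (InnerProductSpace.rankOne ℂ Φ Φ (tensorRight (stdBasis (TensorPow κ H) j) y))⟫_ℂ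
  rw [ContinuousLinearMap.adjoint_inner_right, InnerProductSpace.rankOne_apply, inner_smul_right,
    mul_comm]
  rfl

theorem isSymmetric_partialTrace (x y : TensorPow ι H) :
    ⟪partialTrace (InnerProductSpace.rankOne ℂ Φ Φ) x, y⟫_ℂ =
      ⟪x, partialTrace (InnerProductSpace.rankOne ℂ Φ Φ) y⟫_ℂ := by
  have h := (hasSum_inner_partialTrace Φ y x).mapL Complex.conjCLE.toContinuousLinearMap
  have h' := hasSum_inner_partialTrace Φ x y
  rw [← inner_conj_symm]
  refine HasSum.unique ?_ h'
  refine Eq.mpr (congrArg (fun f => HasSum f _) (funext fun j => ?_)) h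
  change _ = starRingEnd ℂ _
  rw [map_mul, inner_conj_symm, inner_conj_symm, mul_comm]

theorem hasSum_re_inner_partialTrace (x : TensorPow ι H) :
    HasSum (fun j => ‖⟪tmul x (stdBasis (TensorPow κ H) j), Φ⟫_ℂ‖ ^ 2)
      (⟪x, partialTrace (InnerProductSpace.rankOne ℂ Φ Φ) x⟫_ℂ).re := by
  have h := (hasSum_inner_partialTrace Φ x x).mapL Complex.reCLM
  refine Eq.mpr (congrArg (fun f => HasSum f _) (funext fun j => ?_)) h
  rw [← inner_conj_symm Φ, Complex.mul_conj, Complex.normSq_eq_norm_sq]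
  exact (Complex.ofReal_re _).symm

theorem partialTrace_nonneg : 0 ≤ partialTrace (ι := ι) (InnerProductSpace.rankOne ℂ Φ Φ) := by
  rw [ContinuousLinearMap.nonneg_iff_isPositive, ContinuousLinearMap.isPositive_def]
  refine ⟨isSymmetric_partialTrace Φ, fun x => ?_⟩
  rw [ContinuousLinearMap.reApplyInnerSelf_apply, isSymmetric_partialTrace]
  exact (hasSum_re_inner_partialTrace Φ x).nonneg fun _ => by positivity

/-- Parseval's identity in the product basis, summed first over the traced factors. -/
theorem posTrace_partialTrace :
    posTrace (partialTrace (ι := ι) (InnerProductSpace.rankOne ℂ Φ Φ)) =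
      ENNReal.ofReal (‖Φ‖ ^ 2) := by
  obtain ⟨B, hB⟩ := exists_hilbertBasis_tmul (stdBasis (TensorPow ι H)) (stdBasis (TensorPow κ H))
  rw [← tsum_enorm_inner_sq B, ENNReal.tsum_prod', posTrace]
  refine tsum_congr fun i => ?_
  have h := hasSum_re_inner_partialTrace Φ (stdBasis (TensorPow ι H) i)
  rw [← h.tsum_eq, ENNReal.ofReal_tsum_of_nonneg (fun _ => by positivity) h.summable]
  simp only [hB]

/-- The purity of a reduced density matrix is the expectation of the exchange of the retained
factors between two copies of the state. -/
theorem hasSum_norm_inner_partialTrace_sq :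
    HasSum (fun p : stdIndex (TensorPow ι H) × stdIndex (TensorPow ι H) =>
      ((‖⟪stdBasis (TensorPow ι H) p.1, partialTrace (InnerProductSpace.rankOne ℂ Φ Φ)
        (stdBasis (TensorPow ι H) p.2)⟫_ℂ‖ ^ 2 : ℝ) : ℂ))
      ⟪tmul Φ Φ, reindex (pairSwap ι κ) (tmul Φ Φ)⟫_ℂ := by
  set b := stdBasis (TensorPow ι H)
  set b' := stdBasis (TensorPow κ H)
  obtain ⟨B, hB⟩ := exists_hilbertBasis_tmul b b'
  obtain ⟨B₂, hB₂⟩ := exists_hilbertBasis_tmul B B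
  have h := B₂.hasSum_inner_mul_inner (tmul Φ Φ) (reindex (pairSwap ι κ) (tmul Φ Φ))
  have hterm : ∀ p, ⟪tmul Φ Φ, B₂ p⟫_ℂ * ⟪B₂ p, reindex (pairSwap ι κ) (tmul Φ Φ)⟫_ℂ =
      (⟪tmul (b p.2.1) (b' p.1.2), Φ⟫_ℂ * ⟪Φ, tmul (b p.1.1) (b' p.1.2)⟫_ℂ) *
      (⟪tmul (b p.1.1) (b' p.2.2), Φ⟫_ℂ * ⟪Φ, tmul (b p.2.1) (b' p.2.2)⟫_ℂ) := by
    intro p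
    have hs : ⟪B₂ p, reindex (pairSwap ι κ) (tmul Φ Φ)⟫_ℂ =
        ⟪reindex (pairSwap ι κ) (B₂ p), tmul Φ Φ⟫_ℂ := by
      rw [← inner_reindex (pairSwap ι κ), ← reindex_trans (pairSwap ι κ) (pairSwap ι κ)]
      have : (pairSwap ι κ).trans (pairSwap ι κ) = Equiv.refl _ := by
        ext ((i | i) | (i | i)) <;> rfl
      rw [this, reindex_refl]
    rw [hs, hB₂, hB, hB, reindex_pairSwap, inner_tmul, inner_tmul]
    ring
  simp only [hterm] at h
  -- With the two retained indices grouped together, the sum over the two traced indices factorises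
  -- into two matrix elements, conjugate to each other by symmetry.
  rw [← (Equiv.prodProdProdComm _ _ _ _).hasSum_iff] at h
  refine HasSum.prod_fiberwise h fun p => ?_
  have hf := hasSum_inner_partialTrace Φ (b p.2) (b p.1)
  have hg := hasSum_inner_partialTrace Φ (b p.1) (b p.2)
  have hfg := hf.mul hg (h.summable.prod_factor p)
  rw [← isSymmetric_partialTrace, ← inner_conj_symm, Complex.conj_mul', ← Complex.ofReal_pow]
    at hfg
  exact hfg

theorem posTrace_partialTrace_sq :
    0 ≤ (⟪tmul Φ Φ, reindex (pairSwap ι κ) (tmul Φ Φ)⟫_ℂ).re ∧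
    posTrace (partialTrace (ι := ι) (InnerProductSpace.rankOne ℂ Φ Φ) ^ 2) =
      ENNReal.ofReal (⟪tmul Φ Φ, reindex (pairSwap ι κ) (tmul Φ Φ)⟫_ℂ).re := by
  have h := (hasSum_norm_inner_partialTrace_sq (ι := ι) Φ).mapL Complex.reCLM
  simp only [Complex.reCLM_apply, Complex.ofReal_re] at h
  refine ⟨h.nonneg fun _ => by positivity, ?_⟩
  rw [← h.tsum_eq, ENNReal.ofReal_tsum_of_nonneg (fun _ => by positivity) h.summable,
    ENNReal.tsum_prod', ENNReal.tsum_comm, posTrace]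
  refine tsum_congr fun i => ?_
  dsimp only
  rw [tsum_enorm_inner_sq, sq, ContinuousLinearMap.mul_def, ContinuousLinearMap.comp_apply, ← isSymmetric_partialTrace,
    inner_self_eq_norm_sq_to_K]
  norm_cast

end PartialTrace

/-! ### The purity of fermionic reduced density matrices. -/

section Purity

variable {H : Type*} [NormedAddCommGroup H] [InnerProductSpace ℂ H]

variable (H) in
/-- The unitary representation of the permutations of two copies of `Fin N` on the tensor power,
twisted by the sign. -/
def signedPermRep (N : ℕ) :
    Equiv.Perm (Fin N ⊕ Fin N) →*
      (TensorPow (Fin N ⊕ Fin N) H →L[ℂ] TensorPow (Fin N ⊕ Fin N) H) where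
  toFun π := ((Equiv.Perm.sign π : ℤ) : ℂ) • reindex π
  map_one' := by
    ext1 x
    simp only [map_one, Units.val_one, Int.cast_one, one_smul]
    exact reindex_refl x
  map_mul' π σ := by
    ext1 x
    have h : reindex (π * σ) x = reindex π (reindex σ x) := reindex_trans σ π x
    simp only [ContinuousLinearMap.mul_def, ContinuousLinearMap.comp_apply,
      smul_apply, map_smul, smul_smul, h, map_mul]
    push_cast
    rw [mul_comm]

theorem signedPermRep_apply {N : ℕ} (π : Equiv.Perm (Fin N ⊕ Fin N))
    (x : TensorPow (Fin N ⊕ Fin N) H) :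
    signedPermRep H N π x = ((Equiv.Perm.sign π : ℤ) : ℂ) • reindex π x := rfl

theorem inner_signedPermRep {N : ℕ} (π : Equiv.Perm (Fin N ⊕ Fin N))
    (x y : TensorPow (Fin N ⊕ Fin N) H) :
    ⟪signedPermRep H N π x, signedPermRep H N π y⟫_ℂ = ⟪x, y⟫_ℂ := by
  rw [signedPermRep_apply, signedPermRep_apply, inner_smul_left, inner_smul_right, inner_reindex]
  rcases Int.units_eq_one_or (Equiv.Perm.sign π) with h | h <;> simp [h]

theorem reindex_of_mem_fermionic {N : ℕ} {Ψ : TensorPow (Fin N) H} (hΨ : Ψ ∈ fermionic N H)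
    (σ : Equiv.Perm (Fin N)) : reindex σ Ψ = ((Equiv.Perm.sign σ : ℤ) : ℂ) • Ψ := by
  have h := hΨ σ.symm
  rwa [Equiv.Perm.sign_symm] at h

/-- The sign of a block permutation in `signedPermRep` cancels the signs produced by the
antisymmetry of the two copies. -/
theorem tmul_self_mem_biInvariant {N : ℕ} {Ψ : TensorPow (Fin N) H} (hΨ : Ψ ∈ fermionic N H) :
    tmul Ψ Ψ ∈ biInvariant (signedPermRep H N) := by
  rintro _ ⟨⟨σ, τ⟩, rfl⟩
  have h : reindex (Equiv.Perm.sumCongrHom (Fin N) (Fin N) (σ, τ)) (tmul Ψ Ψ) =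
      tmul (reindex σ Ψ) (reindex τ Ψ) := reindex_tmul σ τ Ψ Ψ
  rw [signedPermRep_apply, h, reindex_of_mem_fermionic hΨ, reindex_of_mem_fermionic hΨ,
    Equiv.Perm.sumCongrHom_apply, Equiv.Perm.sign_sumCongr]
  rcases Int.units_eq_one_or (Equiv.Perm.sign σ) with h₁ | h₁ <;>
    rcases Int.units_eq_one_or (Equiv.Perm.sign τ) with h₂ | h₂ <;> simp [h₁, h₂]

theorem norm_tmul_self {N : ℕ} {Ψ : TensorPow (Fin N) H} (hΨ : ‖Ψ‖ = 1) : ‖tmul Ψ Ψ‖ = 1 := by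
  have h := inner_tmul Ψ Ψ Ψ Ψ
  simp only [inner_self_eq_norm_sq_to_K, hΨ] at h
  have h2 : ‖tmul Ψ Ψ‖ ^ 2 = 1 := by
    have h3 : ((‖tmul Ψ Ψ‖ ^ 2 : ℝ) : ℂ) = (1 : ℝ) := by
      push_cast
      simpa using h
    exact_mod_cast h3
  exact (pow_eq_one_iff_of_nonneg (norm_nonneg _) two_ne_zero).1 h2

/-- The exchange of the first `k` particles between two copies of the system. -/
def firstSwap {k N : ℕ} (hk : k ≤ N) : Equiv.Perm (Fin N ⊕ Fin N) :=
  ((splitEquiv hk).sumCongr (splitEquiv hk)).trans ((pairSwap (Fin k) (Fin (N - k))).trans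
    ((splitEquiv hk).sumCongr (splitEquiv hk)).symm)

theorem sign_firstSwap {k N : ℕ} (hk : k ≤ N) : Equiv.Perm.sign (firstSwap hk) = (-1) ^ k := by
  rw [firstSwap, ← Equiv.trans_assoc, Equiv.Perm.sign_trans_trans_symm, sign_pairSwap,
    Fintype.card_fin]

theorem crossing_firstSwap {k N : ℕ} (hk : k ≤ N) : crossing (firstSwap hk) = k := by
  have h : ∀ i, (firstSwap hk (Sum.inl i)).isRight = (splitEquiv hk i).isLeft := by
    intro i
    simp only [firstSwap, Equiv.trans_apply, Equiv.sumCongr_apply, Sum.map_inl]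
    rcases splitEquiv hk i with j | j <;> rfl
  have e : {i // (firstSwap hk (Sum.inl i)).isRight = true} ≃
      {x : Fin k ⊕ Fin (N - k) // x.isLeft = true} :=
    (splitEquiv hk).subtypeEquiv fun i => by rw [h]
  rw [crossing, Fintype.card_congr e, Fintype.card_subtype, Finset.card_filter,
    Fintype.sum_sum_type]
  simp

theorem posTrace_reducedDensity {k N : ℕ} (hk : k ≤ N) {Ψ : TensorPow (Fin N) H} (hΨ : ‖Ψ‖ = 1) :
    posTrace (reducedDensity hk Ψ) = 1 := by
  have h : ‖reindex (splitEquiv hk) Ψ‖ ^ 2 = 1 := by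
    have h1 := inner_reindex (splitEquiv hk) Ψ Ψ
    simp only [inner_self_eq_norm_sq_to_K, hΨ] at h1
    have h3 : ((‖reindex (splitEquiv hk) Ψ‖ ^ 2 : ℝ) : ℂ) = (1 : ℝ) := by
      push_cast
      simpa using h1
    exact_mod_cast h3
  rw [reducedDensity, posTrace_partialTrace, h, ENNReal.ofReal_one]

theorem posTrace_reducedDensity_sq {k N : ℕ} (hk : k ≤ N) (Ψ : TensorPow (Fin N) H) :
    0 ≤ (⟪tmul Ψ Ψ, reindex (firstSwap hk) (tmul Ψ Ψ)⟫_ℂ).re ∧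
    posTrace (reducedDensity hk Ψ ^ 2) =
      ENNReal.ofReal (⟪tmul Ψ Ψ, reindex (firstSwap hk) (tmul Ψ Ψ)⟫_ℂ).re := by
  have h := posTrace_partialTrace_sq (reindex (splitEquiv hk) Ψ)
  have e : ⟪tmul Ψ Ψ, reindex (firstSwap hk) (tmul Ψ Ψ)⟫_ℂ =
      ⟪tmul (reindex (splitEquiv hk) Ψ) (reindex (splitEquiv hk) Ψ),
        reindex (pairSwap (Fin k) (Fin (N - k)))
          (tmul (reindex (splitEquiv hk) Ψ) (reindex (splitEquiv hk) Ψ))⟫_ℂ := by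
    rw [← reindex_tmul, ← inner_reindex ((splitEquiv hk).sumCongr (splitEquiv hk)), firstSwap,
      reindex_trans, reindex_trans, ← reindex_trans _ ((splitEquiv hk).sumCongr _),
      Equiv.symm_trans_self, reindex_refl]
  rw [e]
  exact h

theorem inner_signedPermRep_firstSwap {k N : ℕ} (hk : k ≤ N) (X : TensorPow (Fin N ⊕ Fin N) H) :
    (⟪X, signedPermRep H N (firstSwap hk) X⟫_ℂ).re =
      (-1) ^ k * (⟪X, reindex (firstSwap hk) X⟫_ℂ).re := by
  rw [signedPermRep_apply, sign_firstSwap, inner_smul_right,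
    show (((((-1) ^ k : ℤˣ) : ℤ)) : ℂ) = (((-1) ^ k : ℝ) : ℂ) by push_cast; rfl,
    Complex.re_ofReal_mul]

/-- The purity of the `k`-particle reduced density matrix of a fermionic state of `N` particles is
of order `N ^ (-k)`. -/
theorem exists_posTrace_reducedDensity_sq_le (k : ℕ) :
    ∃ D : ℝ, 0 < D ∧ ∀ (H : Type u) [NormedAddCommGroup H] [InnerProductSpace ℂ H] (N : ℕ)
      (_ : 1 ≤ N) (hk : k ≤ N) (Ψ : TensorPow (Fin N) H), Ψ ∈ fermionic N H → ‖Ψ‖ = 1 →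
        posTrace (reducedDensity hk Ψ ^ 2) ≤ ENNReal.ofReal (D / (N : ℝ) ^ k) := by
  -- The order `2 k + 1` is odd, so that its signed coefficient is nonpositive, and exceeds `k`.
  obtain ⟨D, hD⟩ := exists_abs_crossPoly_le (k := k) (m := 2 * k) (by omega)
  -- The second term serves `N ≤ 2 (2 k + 1)`, where the uniform polynomial bounds are replaced by
  -- purity at most `1`.
  set M : ℝ := max D (((2 * (2 * k + 1) : ℕ) : ℝ) ^ k) with hM
  refine ⟨M, lt_max_of_lt_right (by positivity), fun H _ _ N hN hk Ψ hΨ hΨ1 => ?_⟩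
  obtain ⟨hp, hp'⟩ := posTrace_reducedDensity_sq hk Ψ
  rw [hp']
  refine ENNReal.ofReal_le_ofReal ?_
  have hN0 : (0 : ℝ) < N := by exact_mod_cast hN
  rw [le_div_iff₀ (by positivity), mul_comm]
  set p := (⟪tmul Ψ Ψ, reindex (firstSwap hk) (tmul Ψ Ψ)⟫_ℂ).re with hpdef
  have hX := tmul_self_mem_biInvariant hΨ
  have hX1 := norm_tmul_self hΨ1
  rcases le_total (2 * (2 * k + 1)) N with hle | hle
  · have hm : 2 * k + 1 ≤ N := by omega
    have : Nonempty (Fin N) := ⟨⟨0, by omega⟩⟩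
    have hneg : (⟪tmul Ψ Ψ, signedPermRep H N (firstSwap hm) (tmul Ψ Ψ)⟫_ℂ).re ≤ 0 := by
      rw [inner_signedPermRep_firstSwap, Odd.neg_one_pow ⟨k, rfl⟩]
      have := (posTrace_reducedDensity_sq hm Ψ).1
      linarith
    have h := card_pow_mul_abs_inner_le inner_signedPermRep hX hX1 (k := k) (m := 2 * k) (D := D)
      (by
        rw [Fintype.card_fin]
        exact hD N (by exact_mod_cast hle))
      (by rwa [Fintype.card_fin]) (crossing_firstSwap hk) (crossing_firstSwap hm) hneg
      (by rwa [Fintype.card_fin])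
    rw [inner_signedPermRep_firstSwap, abs_mul, abs_pow, abs_neg, abs_one, one_pow, one_mul,
      abs_of_nonneg hp, Fintype.card_fin] at h
    exact h.trans (le_max_left _ _)
  · have hp1 : p ≤ 1 := by
      have h1 : p ≤ ‖tmul Ψ Ψ‖ * ‖reindex (firstSwap hk) (tmul Ψ Ψ)‖ :=
        (Complex.re_le_norm _).trans (norm_inner_le_norm _ _)
      have h2 : ‖reindex (firstSwap hk) (tmul Ψ Ψ)‖ = ‖tmul Ψ Ψ‖ := by
        rw [@norm_eq_sqrt_re_inner ℂ, @norm_eq_sqrt_re_inner ℂ _ _ _ _ (tmul Ψ Ψ), inner_reindex]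
      rwa [h2, hX1, one_mul] at h1
    calc (N : ℝ) ^ k * p ≤ (N : ℝ) ^ k * 1 := by gcongr
      _ ≤ ((2 * (2 * k + 1) : ℕ) : ℝ) ^ k := by
          rw [mul_one]
          gcongr
      _ ≤ M := le_max_right _ _

end Purity

/-! ### From purity to entropy. -/

section EntropyBound

variable {E : Type*} [NormedAddCommGroup E] [InnerProductSpace ℂ E] [CompleteSpace E]

theorem renyiTwoEntropy_ge {γ : E →L[ℂ] E} {s : ℝ} (hs : 0 < s)
    (hγ : posTrace (γ ^ 2) ≤ ENNReal.ofReal s) :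
    ((-Real.log s : ℝ) : EReal) ≤ renyiTwoEntropy γ := by
  rw [renyiTwoEntropy, EReal.coe_neg, EReal.neg_le_neg_iff, ← ENNReal.log_ofReal_of_pos hs]
  exact ENNReal.log_le_log hγ

/-- This is `log (x / s) ≤ x / s - 1` multiplied by `-x`. It bounds the entropy by the trace and the
purity alone. -/
theorem negMulLog_ge {s x : ℝ} (hs : 0 < s) (hx : 0 ≤ x) :
    (1 - Real.log s) * x - s⁻¹ * x ^ 2 ≤ Real.negMulLog x := by
  rcases hx.eq_or_lt with rfl | hx
  · simp
  · have h := Real.log_le_sub_one_of_pos (div_pos hx hs)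
    rw [Real.log_div hx.ne' hs.ne'] at h
    have h2 : x * (Real.log x - Real.log s) ≤ x * (x / s - 1) := by gcongr
    rw [Real.negMulLog]
    have h3 : x * (x / s - 1) = s⁻¹ * x ^ 2 - x := by
      field_simp
    linarith

theorem vonNeumannEntropy_ge {γ : E →L[ℂ] E} (hγ0 : 0 ≤ γ) (htr : posTrace γ = 1) {s : ℝ}
    (hs : 0 < s) (hγ : posTrace (γ ^ 2) ≤ ENNReal.ofReal s) :
    ((-Real.log s : ℝ) : EReal) ≤ vonNeumannEntropy γ := by
  have hop : (1 - Real.log s) • γ - s⁻¹ • γ ^ 2 ≤ cfc Real.negMulLog γ := by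
    have h1 : (1 - Real.log s) • γ - s⁻¹ • γ ^ 2 =
        cfc (fun x : ℝ => (1 - Real.log s) * x - s⁻¹ * x ^ 2) γ := by
      have ha : IsSelfAdjoint γ := IsSelfAdjoint.of_nonneg hγ0
      rw [cfc_sub (fun x : ℝ => (1 - Real.log s) * x) (fun x : ℝ => s⁻¹ * x ^ 2) γ,
        cfc_const_mul (1 - Real.log s) (fun x : ℝ => x) γ, cfc_const_mul s⁻¹ (fun x : ℝ => x ^ 2) γ,
        cfc_pow (fun x : ℝ => x) 2 γ, cfc_id' ℝ γ]
    rw [h1]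
    refine cfc_mono (fun x hx => negMulLog_ge hs (spectrum_nonneg_of_nonneg hγ0 hx)) ?_ ?_
    · fun_prop
    · exact Real.continuous_negMulLog.continuousOn
  -- The quadratic term is moved to the right so that the sums run in `[0, ∞]`, where
  -- `ENNReal.ofReal` truncates negative values.
  have hterm : ∀ x : E, ENNReal.ofReal (1 - Real.log s) * ENNReal.ofReal (⟪x, γ x⟫_ℂ).re ≤
      ENNReal.ofReal (⟪x, cfc Real.negMulLog γ x⟫_ℂ).re +
      ENNReal.ofReal s⁻¹ * ENNReal.ofReal (⟪x, (γ ^ 2) x⟫_ℂ).re := by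
    intro x
    have h1 := ((ContinuousLinearMap.nonneg_iff_isPositive _).1
      (sub_nonneg.2 hop)).re_inner_nonneg_right x
    have hsmul : ∀ (r : ℝ) (T : E →L[ℂ] E), (⟪x, (r • T) x⟫_ℂ).re = r * (⟪x, T x⟫_ℂ).re := by
      intro r T
      rw [smul_apply, ← Complex.coe_smul, inner_smul_right, Complex.re_ofReal_mul]
    have h2 : (1 - Real.log s) * (⟪x, γ x⟫_ℂ).re ≤
        (⟪x, cfc Real.negMulLog γ x⟫_ℂ).re + s⁻¹ * (⟪x, (γ ^ 2) x⟫_ℂ).re := by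
      simp only [sub_apply, inner_sub_right, map_sub, RCLike.re_to_complex, hsmul] at h1
      linarith
    rcases le_total 0 (1 - Real.log s) with h | h
    · rw [← ENNReal.ofReal_mul h, ← ENNReal.ofReal_mul (by positivity)]
      exact (ENNReal.ofReal_le_ofReal h2).trans ENNReal.ofReal_add_le
    · rw [ENNReal.ofReal_of_nonpos h, zero_mul]
      exact zero_le
  -- Trace one and `Tr γ² ≤ s` turn the operator inequality into `1 - log s ≤ S + 1`; the two units
  -- cancel.
  have hsum : ENNReal.ofReal (1 - Real.log s) ≤ posTrace (cfc Real.negMulLog γ) + 1 := by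
    calc ENNReal.ofReal (1 - Real.log s) = ENNReal.ofReal (1 - Real.log s) * posTrace γ := by
          rw [htr, mul_one]
      _ ≤ posTrace (cfc Real.negMulLog γ) + ENNReal.ofReal s⁻¹ * posTrace (γ ^ 2) := by
          simp only [posTrace]
          rw [← ENNReal.tsum_mul_left, ← ENNReal.tsum_mul_left, ← ENNReal.tsum_add]
          exact ENNReal.tsum_le_tsum fun i => hterm _
      _ ≤ posTrace (cfc Real.negMulLog γ) + ENNReal.ofReal s⁻¹ * ENNReal.ofReal s := by gcongr
      _ = posTrace (cfc Real.negMulLog γ) + 1 := by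
          rw [← ENNReal.ofReal_mul (by positivity), inv_mul_cancel₀ hs.ne', ENNReal.ofReal_one]
  rw [vonNeumannEntropy]
  generalize posTrace (cfc Real.negMulLog γ) = S at hsum
  induction S with
  | top => simp
  | coe r =>
    have h : ENNReal.ofReal (1 - Real.log s) ≤ ENNReal.ofReal ((r : ℝ) + 1) := by
      rwa [ENNReal.ofReal_add r.coe_nonneg zero_le_one, ENNReal.ofReal_coe_nnreal, ENNReal.ofReal_one]
    rw [ENNReal.ofReal_le_ofReal_iff (by positivity)] at h
    have h' : -Real.log s ≤ (r : ℝ) := by linarith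
    rw [EReal.coe_nnreal_eq_coe_real]
    exact EReal.coe_le_coe h'

end EntropyBound

end ManyBody

end

theorem mainTheorem2 (k : ℕ) :
    ∃ C : ℝ, ∀ (H : Type u) [NormedAddCommGroup H] [InnerProductSpace ℂ H] [CompleteSpace H]
      [TopologicalSpace.SeparableSpace H] (N : ℕ) (_ : 1 ≤ N) (hk : k ≤ N)
      (Ψ : ManyBody.TensorPow (Fin N) H), Ψ ∈ ManyBody.fermionic N H → ‖Ψ‖ = 1 →
        ((k * Real.log N - C : ℝ) : EReal) ≤
            ManyBody.vonNeumannEntropy (ManyBody.reducedDensity hk Ψ) ∧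
        ((k * Real.log N - C : ℝ) : EReal) ≤
            ManyBody.renyiTwoEntropy (ManyBody.reducedDensity hk Ψ) := by
  obtain ⟨D, hD, h⟩ := ManyBody.exists_posTrace_reducedDensity_sq_le.{u} k
  refine ⟨Real.log D, fun H _ _ _ _ N hN hk Ψ hΨ hΨ1 => ?_⟩
  have hN0 : (0 : ℝ) < N := by exact_mod_cast hN
  have hs : 0 < D / (N : ℝ) ^ k := by positivity
  have hlog : (k : ℝ) * Real.log N - Real.log D = -Real.log (D / (N : ℝ) ^ k) := by
    rw [Real.log_div hD.ne' (by positivity), Real.log_pow]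
    ring
  have hp := h H N hN hk Ψ hΨ hΨ1
  rw [hlog]
  exact ⟨ManyBody.vonNeumannEntropy_ge (ManyBody.partialTrace_nonneg _)
    (ManyBody.posTrace_reducedDensity hk hΨ1) hs hp, ManyBody.renyiTwoEntropy_ge hs hp⟩
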